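/- For $r,j\in\mathbb N$ with $(r,j)=1$ and real numbers $H,M$ with $1\le H\le M\le r$, let $E_2(r,j,M,H)$ denote the number of tuples $(m_1,\dots,m_4,x_1,\dots,x_4)$ consisting of integers $1\le m_i\le M$ and residue classes $x_i$ modulo $r$ with $x_i^2\equiv jm_i \bmod r$ (that is, $x_i$ runs over all modular square roots $\sqrt{jm_i}$ modulo $r$) such that $$1\le |m_i-m_{i+1}|\le H\ \text{ for } i=1,3,\qquad x_1-x_2\equiv x_3-x_4 \bmod r,$$ and let $E_4(r,j,M,H)$ denote the number of tuples $(m_1,\dots,m_8,x_1,\dots,x_8)$ consisting of integers $1\le m_i\le M$ and residue classes $x_i$ modulo $r$ with $x_i^2\equiv jm_i\bmod r$ such that $$1\le |m_i-m_{i+1}|\le H\ \text{ for } i=1,3,5,7,\qquad x_1-x_2+x_3-x_4\equiv x_5-x_6+x_7-x_8 \bmod r.$$ Then for every $\varepsilon>0$ there is a constant $C>0$, depending only on $\varepsilon$, such that for all $r,j\in\mathbb N$ (with $r$ not necessarily prime) satisfying $(r,j)=1$ and all real $H,M$ with $1\le H\le M\le r$, $$E_2(r,j,M,H)\le C\left(\frac{H^3M^2}{r}+HM\right)r^{\varepsilon}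 \quad\text{and}\quad E_4(r,j,M,H)\le C\,H^2M^2\left(\frac{H^3M^2}{r}+HM\right)r^{\varepsilon}.$$ -/

import Mathlib

/-- The collection `√s` of all modular square roots of `s` modulo `r`. -/
def modSqrt (r : ℕ) (s : ℕ) : Set (ZMod r) := {x | x ^ 2 = (s : ZMod r)}

/-- The pair `a, b` satisfies `1 ≤ |a - b| ≤ H`. -/
def ClosePair (H : ℝ) (a b : ℕ) : Prop :=
  1 ≤ |(a : ℝ) - (b : ℝ)| ∧ |(a : ℝ) - (b : ℝ)| ≤ H

/-- Choices of `n` integers `1 ≤ m_i ≤ M`, each with a modular square root `x_i` of `j * m_i`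
modulo `r`. -/
def rootTuples (n r j : ℕ) (M : ℝ) : Set ((Fin n → ℕ) × (Fin n → ZMod r)) :=
  {p | ∀ i, 1 ≤ p.1 i ∧ (p.1 i : ℝ) ≤ M ∧ p.2 i ∈ modSqrt r (j * p.1 i)}

theorem rootTuples_finite (n r j : ℕ) (M : ℝ) (hr : 0 < r) : (rootTuples n r j M).Finite := by
  have : NeZero r := ⟨hr.ne'⟩
  refine Set.Finite.subset
    ((Set.Finite.pi' (fun _ : Fin n => Set.finite_Iic ⌊M⌋₊)).prod (Set.toFinite Set.univ)) ?_
  intro p hp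
  exact ⟨fun i => Nat.le_floor (hp i).2.1, Set.mem_univ _⟩

/-- The set counted by the restricted energy `E₂(r, j, M, H)`. -/
def energySet2 (r j : ℕ) (M H : ℝ) : Set ((Fin 4 → ℕ) × (Fin 4 → ZMod r)) :=
  {p | p ∈ rootTuples 4 r j M ∧
    ClosePair H (p.1 0) (p.1 1) ∧ ClosePair H (p.1 2) (p.1 3) ∧
    p.2 0 - p.2 1 = p.2 2 - p.2 3}

/-- The set counted by the restricted energy `E₄(r, j, M, H)`. -/
def energySet4 (r j : ℕ) (M H : ℝ) : Set ((Fin 8 → ℕ) × (Fin 8 → ZMod r)) :=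
  {p | p ∈ rootTuples 8 r j M ∧
    ClosePair H (p.1 0) (p.1 1) ∧ ClosePair H (p.1 2) (p.1 3) ∧
    ClosePair H (p.1 4) (p.1 5) ∧ ClosePair H (p.1 6) (p.1 7) ∧
    p.2 0 - p.2 1 + p.2 2 - p.2 3 = p.2 4 - p.2 5 + p.2 6 - p.2 7}

theorem energySet2_finite (r j : ℕ) (M H : ℝ) (hr : 0 < r) : (energySet2 r j M H).Finite :=
  (rootTuples_finite 4 r j M hr).subset fun _ hp => hp.1

theorem energySet4_finite (r j : ℕ) (M H : ℝ) (hr : 0 < r) : (energySet4 r j M H).Finite :=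
  (rootTuples_finite 8 r j M hr).subset fun _ hp => hp.1

/-- The restricted additive energy `E₂(r, j, M, H)`, every choice of the modular square roots being
counted (the set is finite for `0 < r`). -/
noncomputable def E2 (r j : ℕ) (M H : ℝ) : ℕ := (energySet2 r j M H).ncard

/-- The restricted additive energy `E₄(r, j, M, H)`, every choice of the modular square roots being
counted (the set is finite for `0 < r`). -/
noncomputable def E4 (r j : ℕ) (M H : ℝ) : ℕ := (energySet4 r j M H).ncard

/-! Write N(a) for the number of close pairs of points (m, x), x² ≡ jm, whose roots differ by a.
Then E₂ is at most the energy ∑ N(a)² of `fiberEnergy`. In E₄, fixing one pair on each side leaves a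
shifted energy, so E₄ is at most (number of close pairs)² times the same energy
(`card_filter_add_eq_add_le`). Close pairs number ≲ HM r^ε by the second moment of the root count,
so everything rests on `fiberEnergy_closePairs_le`.

Put h = m₁ - m₂ (`gap`) and s = m₁ + m₂ (`tot`). With x₁ - x₂ = a one has jh = a(x₁ + x₂) and (x₁ +
x₂)² = 2js - a². Eliminating the roots, two pairs with the same a satisfy jΔ(h²) ≡ 2a²Δs mod r. If s
is confined to a cell of length V with 2H²V ≤ r, the 2×2 determinants of such vectors (Δ(h²), Δs)
are multiples of r smaller than r, hence vanish: the points (h², s) lie on a line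
(`gap_tot_collinear`), with a direction (g²u, v), g = gcd(a, r) (`exists_cell_line`). The number
P(a) of gaps on it is ≲ V/|v|, by counting steps along the line, and ≲ H/(gu) on average over u up
to r^ε, by counting squares modulo u. The product bounds P(a)², while only about g·gcd(2v, r) values
of a share g, u, v. Summing over u, v, g gives ≲ VH per cell, plus the number of pairs in the cell
(`fiberEnergy_cell_le`). Cauchy–Schwarz over the about 1 + H²M/r cells then yields HM(1 + H²M/r). If
HM ≥ r, the bound N(a) ≤ 4H suffices.

For composite r a congruence x² ≡ z² mod r can have many solutions when x and z share a factor e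
with e² ∣ r. Such factors are removed beforehand: a pair whose roots have largest common factor f,
f² ∣ r, is divided by f and becomes a primitive pair modulo r/f², with H and M replaced by H/f² and
M/f². The at most f⁴ lifts of a pair of pairs are paid for by this rescaling.

Throughout, T dominates both the divisor counts up to r and the harmonic sums up to 4r. -/

section

open Finset

/-! ### The divisor bound. -/

/-- The divisor bound. -/
theorem exists_card_divisors_le_rpow {ε : ℝ} (hε : 0 < ε) :
    ∃ C : ℝ, 1 ≤ C ∧ ∀ n : ℕ, n ≠ 0 → (n.divisors.card : ℝ) ≤ C * (n : ℝ) ^ ε := by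
  obtain ⟨A, hA1, hA⟩ : ∃ A : ℝ, 1 ≤ A ∧ ∀ k : ℕ, ((k : ℝ) + 1) ≤ A * ((2 : ℝ) ^ ε) ^ k := by
    have h2 : 1 < (2 : ℝ) ^ ε := Real.one_lt_rpow (by norm_num) hε
    set q := (2 : ℝ) ^ ε with hq
    have hq1 : 0 < q - 1 := by linarith
    have hq2 := one_div_pos.2 hq1
    -- Bernoulli gives k(q - 1) ≤ q^k, which accounts for 1 / (q - 1); the summand 1 absorbs the +1.
    refine ⟨1 + 1 / (q - 1), by linarith, fun k => ?_⟩
    have hb := one_add_mul_le_pow (a := q - 1) (by linarith) k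
    have h1 : (1 : ℝ) ≤ q ^ k := one_le_pow₀ h2.le
    have h3 : (1 : ℝ) + k * (q - 1) ≤ q ^ k := by simpa using hb
    have h4 : (k : ℝ) ≤ 1 / (q - 1) * q ^ k := by
      rw [div_mul_eq_mul_div, le_div_iff₀ hq1]; linarith
    linarith
  -- A prime p ≥ N has p^ε ≥ 2, so k + 1 ≤ 2^k ≤ p^(εk) costs nothing. Only the fewer than N + 1
  -- primes below N cost a factor A each, whence A^N.
  obtain ⟨N, hN⟩ := exists_nat_ge ((2 : ℝ) ^ (1 / ε))
  refine ⟨A ^ N, one_le_pow₀ hA1, fun n hn => ?_⟩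
  have key : ∀ p ∈ n.primeFactors, ((n.factorization p : ℝ) + 1) ≤
      (if p < N then A else 1) * ((p : ℝ) ^ n.factorization p) ^ ε := by
    intro p hp
    have hp2 : (2 : ℝ) ≤ p := by exact_mod_cast (Nat.prime_of_mem_primeFactors hp).two_le
    have hp0 : (0 : ℝ) ≤ p := by linarith
    have hcomm : ((p : ℝ) ^ n.factorization p) ^ ε = ((p : ℝ) ^ ε) ^ n.factorization p := by
      rw [← Real.rpow_natCast, ← Real.rpow_natCast, ← Real.rpow_mul hp0, ← Real.rpow_mul hp0,
        mul_comm]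
    rw [hcomm]
    split_ifs with h
    · refine (hA _).trans ?_
      gcongr
    · have : (2 : ℝ) ≤ (p : ℝ) ^ ε := by
        have h1 : (2 : ℝ) ^ (1 / ε) ≤ p := hN.trans (by exact_mod_cast not_lt.1 h)
        calc (2 : ℝ) = ((2 : ℝ) ^ (1 / ε)) ^ ε := by
              rw [← Real.rpow_mul (by norm_num), one_div_mul_cancel hε.ne', Real.rpow_one]
          _ ≤ _ := by gcongr
      have h3 : ((n.factorization p : ℝ) + 1) ≤ 2 ^ n.factorization p := by
        exact_mod_cast Nat.lt_two_pow_self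
      rw [one_mul]
      exact h3.trans (by gcongr)
  rw [Nat.card_divisors hn]
  push_cast
  refine (Finset.prod_le_prod (fun p _ => by positivity) key).trans ?_
  rw [Finset.prod_mul_distrib]
  have e1 : ∏ p ∈ n.primeFactors, ((p : ℝ) ^ n.factorization p) ^ ε = (n : ℝ) ^ ε := by
    rw [Real.finsetProd_rpow _ _ (fun p _ => by positivity)]
    congr 1
    exact_mod_cast Nat.prod_factorization_pow_eq_self hn
  rw [e1]
  refine mul_le_mul_of_nonneg_right ?_ (by positivity)
  rw [Finset.prod_ite]
  simp only [prod_const, one_pow, mul_one]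
  refine pow_le_pow_right₀ hA1 ?_
  calc _ ≤ (range N).card := card_le_card fun p hp => by simp at hp ⊢; exact hp.2
    _ = N := by simp

/-! ### The congruence x² ≡ z² to a composite modulus. -/

/-- The greatest common divisor of the two complementary divisors `gcd(y, N)` and
`N / gcd(y, N)` of `N`. -/
def splitGcd (N : ℕ) (y : ℤ) : ℕ := Nat.gcd (Int.gcd y N) (N / Int.gcd y N)

theorem splitGcd_mul_self_dvd (N : ℕ) (y : ℤ) : splitGcd N y * splitGcd N y ∣ N := by
  have h : Int.gcd y N ∣ N := by exact_mod_cast Int.gcd_dvd_right y N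
  calc _ ∣ Int.gcd y N * (N / Int.gcd y N) := mul_dvd_mul (Nat.gcd_dvd_left _ _)
        (Nat.gcd_dvd_right _ _)
    _ = N := Nat.mul_div_cancel' h

theorem splitGcd_dvd_self (N : ℕ) (y : ℤ) : splitGcd N y ∣ N :=
  (dvd_mul_right _ _).trans (splitGcd_mul_self_dvd N y)

theorem splitGcd_dvd_left (N : ℕ) (y : ℤ) : (splitGcd N y : ℤ) ∣ y :=
  (Int.natCast_dvd_natCast.2 (Nat.gcd_dvd_left _ _)).trans (Int.gcd_dvd_left _ _)

/-- If `N ∣ y * w`, then `N / gcd(y, N) ∣ w`. -/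
theorem div_gcd_dvd_of_dvd_mul {N : ℕ} (hN : 0 < N) {y w : ℤ} (h : (N : ℤ) ∣ y * w) :
    ((N / Int.gcd y N : ℕ) : ℤ) ∣ w := by
  have hg : 0 < Int.gcd y N := Int.gcd_pos_of_ne_zero_right _ (by exact_mod_cast hN.ne')
  have hcop : IsCoprime ((N / Int.gcd y N : ℕ) : ℤ) (y / Int.gcd y N) := by
    rw [Int.isCoprime_iff_gcd_eq_one, Int.gcd_comm]
    have := Int.gcd_ediv_gcd_ediv_gcd (i := y) (j := N) hg
    simpa using this
  refine hcop.dvd_of_dvd_mul_left ?_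
  have hy : y = Int.gcd y N * (y / Int.gcd y N) := (Int.mul_ediv_cancel' (Int.gcd_dvd_left _ _)).symm
  have hNe : (N : ℤ) = Int.gcd y N * ((N / Int.gcd y N : ℕ) : ℤ) := by
    rw [Int.natCast_div]; exact (Int.mul_ediv_cancel' (Int.gcd_dvd_right _ _)).symm
  have hg' : (Int.gcd y N : ℤ) ≠ 0 := by exact_mod_cast hg.ne'
  obtain ⟨c, hc⟩ := h
  refine ⟨c, mul_left_cancel₀ hg' ?_⟩
  calc _ = (Int.gcd y N * (y / Int.gcd y N)) * w := by ring
    _ = y * w := by rw [← hy]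
    _ = N * c := hc
    _ = (Int.gcd y N * ((N / Int.gcd y N : ℕ) : ℤ)) * c := by rw [← hNe]
    _ = _ := by ring

theorem splitGcd_dvd_of_dvd_mul {N : ℕ} (hN : 0 < N) {y w : ℤ} (h : (N : ℤ) ∣ y * w) :
    (splitGcd N y : ℤ) ∣ w :=
  (Int.natCast_dvd_natCast.2 (Nat.gcd_dvd_right _ _)).trans (div_gcd_dvd_of_dvd_mul hN h)

/-- A set of integers in an interval of length `L` whose differences are multiples of `q`. -/
theorem card_le_of_dvd_sub {S : Finset ℤ} {A : ℤ} {L q : ℕ} (hq : 0 < q)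
    (hI : ∀ x ∈ S, A ≤ x ∧ x ≤ A + L) (hd : ∀ x ∈ S, ∀ y ∈ S, (q : ℤ) ∣ x - y) :
    S.card ≤ L / q + 1 := by
  have : S.card ≤ (range (L / q + 1)).card := by
    have hq' : (0 : ℤ) < q := by exact_mod_cast hq
    refine Finset.card_le_card_of_injOn (fun x => ((x - A) / q).toNat) ?_ ?_
    · intro x hx
      obtain ⟨h1, h2⟩ := hI x hx
      simp only [coe_range, Set.mem_Iio]
      have h4 : (x - A) / q ≤ (L : ℤ) / q := Int.ediv_le_ediv hq' (by linarith)
      have h5 : 0 ≤ (x - A) / q := Int.ediv_nonneg (by linarith) hq'.le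
      have h6 : (((x - A) / q).toNat : ℤ) ≤ ((L / q : ℕ) : ℤ) := by
        rw [Int.toNat_of_nonneg h5]; push_cast; exact h4
      have := Int.ofNat_le.1 h6
      omega
    · intro x hx y hy hxy
      have h5 : 0 ≤ (x - A) / q := Int.ediv_nonneg (by linarith [(hI x hx).1]) hq'.le
      have h6 : 0 ≤ (y - A) / q := Int.ediv_nonneg (by linarith [(hI y hy).1]) hq'.le
      have h7 : (x - A) / q = (y - A) / q := by
        have := congrArg (Nat.cast : ℕ → ℤ) hxy
        simpa [Int.toNat_of_nonneg h5, Int.toNat_of_nonneg h6] using this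
      have h8 : (x - A) % q = (y - A) % q := by
        refine Int.ModEq.symm ((Int.modEq_iff_dvd).2 ?_)
        have := hd x hx y hy
        simpa using this
      have e1 := Int.emod_add_mul_ediv (x - A) q
      have e2 := Int.emod_add_mul_ediv (y - A) q
      rw [h7, h8] at e1
      linarith
  simpa using this

/-- Counting the solutions of `x ^ 2 ≡ z ^ 2` modulo `N` in an interval. -/
theorem card_sq_congr_le {N : ℕ} (hN : 0 < N) {S : Finset ℤ} {A z : ℤ} {L : ℕ} {B : ℝ}
    (hB0 : 0 ≤ B)
    (hI : ∀ x ∈ S, A ≤ x ∧ x ≤ A + L) (hd : ∀ x ∈ S, (N : ℤ) ∣ x ^ 2 - z ^ 2)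
    (hB : ∀ x ∈ S, (splitGcd N (x - z) : ℝ) ≤ B) :
    (S.card : ℝ) ≤ N.divisors.card * (L * B / N + 1) := by
  have hfib : S.card = ∑ d ∈ N.divisors, (S.filter fun x => Int.gcd (x - z) N = d).card := by
    refine Finset.card_eq_sum_card_fiberwise ?_
    intro x _
    simp only [mem_coe, Nat.mem_divisors]
    exact ⟨by exact_mod_cast Int.gcd_dvd_right (x - z) N, hN.ne'⟩
  rw [hfib, ← nsmul_eq_mul]
  push_cast
  refine Finset.sum_le_card_nsmul _ _ _ fun d hdN => ?_
  have hdN' := (Nat.mem_divisors.1 hdN).1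
  rcases (S.filter fun x => Int.gcd (x - z) N = d).eq_empty_or_nonempty with he | ⟨x0, hx0⟩
  · rw [he]; simp; positivity
  have hx0' := Finset.mem_filter.1 hx0
  -- On this fibre d ∣ x - z and N/d ∣ x + z, so x is determined modulo lcm(d, N/d) = N/e. The loss
  -- against modulus N is exactly the factor e that B controls.
  set e := Nat.gcd d (N / d) with he
  have hesplit : splitGcd N (x0 - z) = e := by rw [splitGcd, hx0'.2]
  have heB : (e : ℝ) ≤ B := hesplit ▸ hB x0 hx0'.1
  have hd0 : 0 < d := Nat.pos_of_dvd_of_pos hdN' hN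
  have he0 : 0 < e := Nat.gcd_pos_of_pos_left _ hd0
  have hlcm : Nat.lcm d (N / d) * e = N := by
    rw [mul_comm, Nat.gcd_mul_lcm, Nat.mul_div_cancel' hdN']
  have hl0 : 0 < Nat.lcm d (N / d) := Nat.pos_of_ne_zero fun h => by
    rw [h, zero_mul] at hlcm; omega
  have hc := card_le_of_dvd_sub (S := S.filter fun x => Int.gcd (x - z) N = d) (A := A) (L := L) hl0
    (fun x hx => hI x (Finset.mem_filter.1 hx).1) (by
      have h0 : ∀ x ∈ S.filter (fun x => Int.gcd (x - z) N = d),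
          (d : ℤ) ∣ x - z ∧ ((N / d : ℕ) : ℤ) ∣ x + z := by
        intro x hx
        obtain ⟨hxS, hxd⟩ := Finset.mem_filter.1 hx
        refine ⟨hxd ▸ Int.gcd_dvd_left _ _, ?_⟩
        have := div_gcd_dvd_of_dvd_mul hN (y := x - z) (w := x + z)
          (by have := hd x hxS; convert this using 1; ring)
        rwa [hxd] at this
      intro x hx y hy
      obtain ⟨h1, h2⟩ := h0 x hx
      obtain ⟨h3, h4⟩ := h0 y hy
      have h5 : (d : ℤ) ∣ x - y := by have := dvd_sub h1 h3; simpa using this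
      have h6 : ((N / d : ℕ) : ℤ) ∣ x - y := by have := dvd_sub h2 h4; simpa using this
      rw [Int.natCast_dvd] at h5 h6 ⊢
      exact Nat.lcm_dvd h5 h6)
  calc ((S.filter fun x => Int.gcd (x - z) N = d).card : ℝ)
      ≤ ((L / Nat.lcm d (N / d) + 1 : ℕ) : ℝ) := by exact_mod_cast hc
    _ ≤ (L : ℝ) / (Nat.lcm d (N / d) : ℕ) + 1 := by
        push_cast; gcongr; exact Nat.cast_div_le
    _ = L * e / N + 1 := by
        have : (N : ℝ) = (Nat.lcm d (N / d) : ℕ) * (e : ℝ) := by exact_mod_cast hlcm.symm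
        rw [this, mul_div_mul_right _ _ (by positivity)]
    _ ≤ _ := by gcongr

/-! ### Points, close pairs and their number. -/

/-- The points `(m, x)` with `1 ≤ m ≤ M` and `x ^ 2 = j * m` in `ZMod r`. -/
def rootPts (r j M : ℕ) [NeZero r] : Finset (ℕ × ZMod r) :=
  (Icc 1 M ×ˢ univ).filter fun p => p.2 ^ 2 = ((j * p.1 : ℕ) : ZMod r)

/-- The pairs of points whose first coordinates are distinct and at distance at most `H`. -/
def closePairs (r j M H : ℕ) [NeZero r] : Finset ((ℕ × ZMod r) × (ℕ × ZMod r)) :=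
  (rootPts r j M ×ˢ rootPts r j M).filter fun p =>
    p.1.1 ≠ p.2.1 ∧ |(p.1.1 : ℤ) - p.2.1| ≤ H

/-- The number of modular square roots of `s`. -/
def rootCount (r s : ℕ) [NeZero r] : ℕ := (univ.filter fun x : ZMod r => x ^ 2 = (s : ZMod r)).card

/-- The difference of the square roots in a pair. -/
def pairDiff {r : ℕ} (p : (ℕ × ZMod r) × (ℕ × ZMod r)) : ZMod r := p.1.2 - p.2.2

theorem mem_rootPts {r j M : ℕ} [NeZero r] {p : ℕ × ZMod r} :
    p ∈ rootPts r j M ↔ (1 ≤ p.1 ∧ p.1 ≤ M) ∧ p.2 ^ 2 = ((j * p.1 : ℕ) : ZMod r) := by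
  simp [rootPts]

theorem mem_closePairs {r j M H : ℕ} [NeZero r] {p : (ℕ × ZMod r) × (ℕ × ZMod r)} :
    p ∈ closePairs r j M H ↔ (p.1 ∈ rootPts r j M ∧ p.2 ∈ rootPts r j M) ∧
      p.1.1 ≠ p.2.1 ∧ |(p.1.1 : ℤ) - p.2.1| ≤ H := by
  simp [closePairs]

theorem val_injective_int {r : ℕ} [NeZero r] :
    Function.Injective fun x : ZMod r => ((x.val : ℕ) : ℤ) := fun x y h => by
  have : x.val = y.val := Int.ofNat_injective h
  exact ZMod.val_injective r this

theorem val_mem_interval {r : ℕ} [NeZero r] (x : ZMod r) :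
    (0 : ℤ) ≤ (x.val : ℤ) ∧ (x.val : ℤ) ≤ 0 + ((r - 1 : ℕ) : ℤ) := by
  have := ZMod.val_lt x
  omega

/-- Counting square roots of a square in a subset of `ZMod r`. -/
theorem card_sq_eq_le {r N : ℕ} [NeZero r] (hN : 0 < N) (hNr : N ≤ r) {T B : ℝ}
    (hT : ∀ n : ℕ, 0 < n → n ≤ r → (n.divisors.card : ℝ) ≤ T) (hB0 : 0 ≤ B)
    {S : Finset (ZMod r)} {z : ℤ} (hd : ∀ x ∈ S, (N : ℤ) ∣ (x.val : ℤ) ^ 2 - z ^ 2)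
    (hB : ∀ x ∈ S, (splitGcd N ((x.val : ℤ) - z) : ℝ) ≤ B) :
    (S.card : ℝ) ≤ T * (r * B / N + 1) := by
  classical
  have h := card_sq_congr_le (S := S.image fun x => ((x.val : ℕ) : ℤ)) (A := 0) (z := z)
    (L := r - 1) hN hB0
    (by
      intro y hy
      obtain ⟨x, -, rfl⟩ := mem_image.1 hy
      exact val_mem_interval x)
    (by
      intro y hy
      obtain ⟨x, hx, rfl⟩ := mem_image.1 hy
      exact hd x hx)
    (by
      intro y hy
      obtain ⟨x, hx, rfl⟩ := mem_image.1 hy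
      exact hB x hx)
  rw [card_image_of_injective _ val_injective_int] at h
  have hr : ((r - 1 : ℕ) : ℝ) ≤ r := by exact_mod_cast Nat.sub_le _ _
  have hT1 := hT N hN hNr
  have hT0 : 0 ≤ T := le_trans (by positivity) hT1
  calc _ ≤ _ := h
    _ ≤ T * (r * B / N + 1) := by gcongr

theorem dvd_of_dvd_coprime_mul {e r j : ℕ} {h : ℤ} (hcop : Nat.Coprime r j) (he : e ∣ r)
    (hd : (e : ℤ) ∣ j * h) : (e : ℤ) ∣ h := by
  have : IsCoprime (e : ℤ) (j : ℤ) := Nat.isCoprime_iff_coprime.2 (Nat.Coprime.coprime_dvd_left he hcop)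
  exact this.dvd_of_dvd_mul_left hd

theorem rootPts_sq_sub_dvd {r j M : ℕ} [NeZero r] {p : ℕ × ZMod r} (hp : p ∈ rootPts r j M) :
    (r : ℤ) ∣ (p.2.val : ℤ) ^ 2 - j * p.1 := by
  have := (mem_rootPts.1 hp).2
  rw [← ZMod.intCast_zmod_eq_zero_iff_dvd]
  push_cast
  rw [ZMod.natCast_zmod_val, this]
  push_cast
  ring

theorem rootPts_eq_of_snd_eq {r j M : ℕ} [NeZero r] (hcop : Nat.Coprime r j) (hM : M ≤ r)
    {p q : ℕ × ZMod r} (hp : p ∈ rootPts r j M) (hq : q ∈ rootPts r j M) (h : p.2 = q.2) :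
    p = q := by
  have h1 := rootPts_sq_sub_dvd hp
  have h2 := rootPts_sq_sub_dvd hq
  rw [h] at h1
  have h3 : (r : ℤ) ∣ j * ((p.1 : ℤ) - q.1) := by
    have := dvd_sub h2 h1
    exact this.trans (dvd_of_eq (by ring))
  have h4 := dvd_of_dvd_coprime_mul hcop dvd_rfl h3
  have hp' := (mem_rootPts.1 hp).1
  have hq' := (mem_rootPts.1 hq).1
  have h5 : (p.1 : ℤ) - q.1 = 0 := by
    refine Int.eq_zero_of_abs_lt_dvd h4 ?_
    rw [abs_lt]; omega
  refine Prod.ext ?_ h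
  omega

/-- For two roots x, x₀ the loss e = `splitGcd` divides x - x₀ and x + x₀, hence 2x; as e² ∣ r and
x² ≡ jm, this forces e² ∣ 4m. The sum over all such e replaces their maximum so that it can be
averaged over m. -/
theorem rootCount_sq_le {r j m : ℕ} [NeZero r] {T : ℝ} (hcop : Nat.Coprime r j)
    (hT : ∀ n : ℕ, 0 < n → n ≤ r → (n.divisors.card : ℝ) ≤ T) :
    (rootCount r (j * m) : ℝ) ^ 2 ≤
      4 * T ^ 2 * ∑ e ∈ r.divisors.filter (fun e => e * e ∣ 4 * m), (e : ℝ) ^ 2 := by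
  have hr : 0 < r := Nat.pos_of_ne_zero (NeZero.ne r)
  set Q := ∑ e ∈ r.divisors.filter (fun e => e * e ∣ 4 * m), (e : ℝ) ^ 2 with hQ
  have hQ1 : 1 ≤ Q := by
    have : ((1 : ℕ) : ℝ) ^ 2 ≤ Q := by
      rw [hQ]
      exact single_le_sum (f := fun e : ℕ => (e : ℝ) ^ 2) (fun _ _ => by positivity)
        (by simp [hr.ne'])
    simpa using this
  have hT0 : 0 ≤ T := le_trans (by positivity) (hT r hr le_rfl)
  rcases (univ.filter fun x : ZMod r => x ^ 2 = ((j * m : ℕ) : ZMod r)).eq_empty_or_nonempty with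
    he | ⟨x0, hx0⟩
  · rw [rootCount, he]; simp; positivity
  have key : ∀ x : ZMod r, x ^ 2 = ((j * m : ℕ) : ZMod r) →
      (r : ℤ) ∣ (x.val : ℤ) ^ 2 - (j * m : ℕ) := by
    intro x hx
    rw [← ZMod.intCast_zmod_eq_zero_iff_dvd]
    push_cast
    rw [ZMod.natCast_zmod_val, hx]
    push_cast
    ring
  have hk0 := key x0 (by simpa using hx0)
  have h := card_sq_eq_le (S := univ.filter fun x : ZMod r => x ^ 2 = ((j * m : ℕ) : ZMod r))
    (z := x0.val) (N := r) (T := T) (B := √Q) hr le_rfl hT (Real.sqrt_nonneg _)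
    (by
      intro x hx
      have := dvd_sub (key x (by simpa using hx)) hk0
      exact this.trans (dvd_of_eq (by ring)))
    (by
      intro x hx
      have hk := key x (by simpa using hx)
      set e := splitGcd r ((x.val : ℤ) - (x0.val : ℤ))
      have he1 : e * e ∣ r := splitGcd_mul_self_dvd _ _
      have he2 : (e : ℤ) ∣ (x.val : ℤ) - x0.val := splitGcd_dvd_left _ _
      have he3 : (e : ℤ) ∣ (x.val : ℤ) + x0.val := splitGcd_dvd_of_dvd_mul hr (by
        have := dvd_sub hk hk0
        exact this.trans (dvd_of_eq (by ring)))
      have he4 : (e : ℤ) ∣ 2 * x.val := by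
        have := dvd_add he2 he3
        exact this.trans (dvd_of_eq (by ring))
      have he5 : ((e * e : ℕ) : ℤ) ∣ j * (4 * m) := by
        have h1 : ((e * e : ℕ) : ℤ) ∣ 4 * ((x.val : ℤ) ^ 2 - (j * m : ℕ)) :=
          ((Int.natCast_dvd_natCast.2 he1).trans hk).mul_left _
        have h2 : ((e * e : ℕ) : ℤ) ∣ (2 * x.val) * (2 * x.val) := by
          push_cast; exact mul_dvd_mul he4 he4
        have := dvd_sub h2 h1
        exact this.trans (dvd_of_eq (by push_cast; ring))
      have he6 : e * e ∣ 4 * m := by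
        have := dvd_of_dvd_coprime_mul hcop he1 he5
        exact_mod_cast this
      refine Real.le_sqrt_of_sq_le ?_
      rw [hQ]
      exact single_le_sum (f := fun e : ℕ => (e : ℝ) ^ 2) (fun _ _ => by positivity)
        (by simp [hr.ne', he6]; exact (dvd_mul_right _ _).trans he1))
  have hr' : (r : ℝ) ≠ 0 := by positivity
  rw [mul_div_cancel_left₀ _ hr'] at h
  have h1 : 1 ≤ √Q := Real.one_le_sqrt.2 hQ1
  have h2 : (rootCount r (j * m) : ℝ) ≤ T * (2 * √Q) := h.trans (by gcongr; linarith)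
  calc _ ≤ (T * (2 * √Q)) ^ 2 := by gcongr
    _ = 4 * T ^ 2 * √Q ^ 2 := by ring
    _ = _ := by rw [Real.sq_sqrt (by linarith)]

/-- After exchanging sums, each e contributes e² times at most 4M/e² values of m. -/
theorem sum_rootCount_sq_le {r j M : ℕ} [NeZero r] {T : ℝ} (hcop : Nat.Coprime r j)
    (hT : ∀ n : ℕ, 0 < n → n ≤ r → (n.divisors.card : ℝ) ≤ T) :
    ∑ m ∈ Icc 1 M, (rootCount r (j * m) : ℝ) ^ 2 ≤ 16 * T ^ 3 * M := by
  have hr : 0 < r := Nat.pos_of_ne_zero (NeZero.ne r)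
  have hT0 : 0 ≤ T := le_trans (by positivity) (hT r hr le_rfl)
  have inner : ∀ e ∈ r.divisors,
      ∑ m ∈ Icc 1 M, (if e * e ∣ 4 * m then (e : ℝ) ^ 2 else 0) ≤ 4 * M := by
    intro e he
    have he0 : 0 < e := Nat.pos_of_mem_divisors he
    rw [← sum_filter, sum_const, nsmul_eq_mul]
    have hc : ((Icc 1 M).filter fun m => e * e ∣ 4 * m).card ≤ 4 * M / (e * e) := by
      rw [← Nat.Ioc_filter_dvd_card_eq_div]
      refine card_le_card_of_injOn (fun m => 4 * m) ?_ ?_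
      · intro m hm
        simp at hm ⊢
        exact ⟨by omega, hm.2⟩
      · intro a _ b _ h
        simpa using h
    calc _ ≤ ((4 * M / (e * e) : ℕ) : ℝ) * (e : ℝ) ^ 2 := by gcongr
      _ ≤ ((4 * M : ℕ) : ℝ) / ((e * e : ℕ) : ℝ) * (e : ℝ) ^ 2 := by gcongr; exact Nat.cast_div_le
      _ = 4 * M := by push_cast; field_simp
  calc _ ≤ ∑ m ∈ Icc 1 M, 4 * T ^ 2 * ∑ e ∈ r.divisors, (if e * e ∣ 4 * m then (e : ℝ) ^ 2 else 0) := by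
        refine sum_le_sum fun m _ => ?_
        rw [← sum_filter]
        exact rootCount_sq_le hcop hT
    _ = 4 * T ^ 2 * ∑ e ∈ r.divisors, ∑ m ∈ Icc 1 M, (if e * e ∣ 4 * m then (e : ℝ) ^ 2 else 0) := by
        rw [← mul_sum, sum_comm]
    _ ≤ 4 * T ^ 2 * ∑ e ∈ r.divisors, 4 * (M : ℝ) := by gcongr with e he; exact inner e he
    _ = 4 * T ^ 2 * (r.divisors.card * (4 * (M : ℝ))) := by rw [sum_const, nsmul_eq_mul]
    _ ≤ 4 * T ^ 2 * (T * (4 * (M : ℝ))) := by gcongr; exact hT r hr le_rfl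
    _ = _ := by ring

/-- There are at most `2 * K` nonzero integers in `[-K, K]` after an injection. -/
theorem card_le_two_mul_of_abs_le {α : Type*} {S : Finset α} {f : α → ℤ} {K : ℕ}
    (hinj : Set.InjOn f S) (h0 : ∀ x ∈ S, f x ≠ 0) (hK : ∀ x ∈ S, |f x| ≤ K) :
    S.card ≤ 2 * K := by
  have : S.card ≤ ((Icc (-(K : ℤ)) K).erase 0).card := by
    refine card_le_card_of_injOn f ?_ hinj
    intro x hx
    simp only [coe_erase, coe_Icc, Set.mem_sdiff, Set.mem_Icc, Set.mem_singleton_iff]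
    exact ⟨abs_le.1 (hK x hx), h0 x hx⟩
  rw [card_erase_of_mem (by simp), Int.card_Icc] at this
  omega

/-- The product of the two root counts is at most the mean of their squares, and each m has at most
2H partners; the second moment finishes. -/
theorem card_closePairs_le {r j M H : ℕ} [NeZero r] {T : ℝ} (hcop : Nat.Coprime r j)
    (hT : ∀ n : ℕ, 0 < n → n ≤ r → (n.divisors.card : ℝ) ≤ T) :
    ((closePairs r j M H).card : ℝ) ≤ 32 * T ^ 3 * H * M := by
  set ρ : ℕ → ℝ := fun m => (rootCount r (j * m) : ℝ) with hρ
  set Z := (Icc 1 M ×ˢ Icc 1 M).filter fun z : ℕ × ℕ => z.1 ≠ z.2 ∧ |(z.1 : ℤ) - z.2| ≤ H with hZ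
  have h1 : (closePairs r j M H).card =
      ∑ z ∈ Z, ((closePairs r j M H).filter fun p => (p.1.1, p.2.1) = z).card := by
    refine card_eq_sum_card_fiberwise ?_
    intro p hp
    have hp' := mem_closePairs.1 hp
    have ha := mem_rootPts.1 hp'.1.1
    have hb := mem_rootPts.1 hp'.1.2
    simp only [hZ, coe_filter, mem_product, mem_Icc, Set.mem_ofPred_eq]
    exact ⟨⟨ha.1, hb.1⟩, hp'.2⟩
  have h2 : ∀ z ∈ Z, (((closePairs r j M H).filter fun p => (p.1.1, p.2.1) = z).card : ℝ) ≤
      (ρ z.1 ^ 2 + ρ z.2 ^ 2) / 2 := by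
    intro z _
    have : ((closePairs r j M H).filter fun p => (p.1.1, p.2.1) = z).card ≤
        rootCount r (j * z.1) * rootCount r (j * z.2) := by
      rw [rootCount, rootCount, ← card_product]
      refine card_le_card_of_injOn (fun p => (p.1.2, p.2.2)) ?_ ?_
      · intro p hp
        simp only [coe_filter, Set.mem_ofPred_eq, mem_closePairs, mem_rootPts] at hp
        obtain ⟨⟨⟨h1, h2⟩, -⟩, h3⟩ := hp
        simp only [coe_product, coe_filter, Set.mem_prod, Set.mem_ofPred_eq, mem_univ, true_and]
        rw [← h3]
        exact ⟨h1.2, h2.2⟩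
      · intro p hp q hq h
        simp only [coe_filter, Set.mem_ofPred_eq] at hp hq
        have := hp.2.trans hq.2.symm
        simp only [Prod.mk.injEq] at this h
        exact Prod.ext (Prod.ext this.1 h.1) (Prod.ext this.2 h.2)
    have h3 : (((closePairs r j M H).filter fun p => (p.1.1, p.2.1) = z).card : ℝ) ≤
        ρ z.1 * ρ z.2 := by simp only [hρ]; exact_mod_cast this
    nlinarith [sq_nonneg (ρ z.1 - ρ z.2)]
  have h3 : ∑ z ∈ Z, ρ z.1 ^ 2 ≤ 2 * H * ∑ m ∈ Icc 1 M, ρ m ^ 2 := by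
    rw [← sum_fiberwise_of_maps_to (s := Z) (t := Icc 1 M) (g := fun z => z.1)
      (fun z hz => (mem_product.1 (mem_filter.1 hz).1).1), mul_sum]
    refine sum_le_sum fun m _ => ?_
    rw [sum_congr rfl (g := fun _ => ρ m ^ 2) (fun z hz => by rw [(mem_filter.1 hz).2]),
      sum_const, nsmul_eq_mul]
    gcongr
    have : (Z.filter fun z => z.1 = m).card ≤ 2 * H := by
      refine card_le_two_mul_of_abs_le (f := fun z => (z.1 : ℤ) - z.2) ?_ ?_ ?_
      · intro z hz w hw h
        have e1 := (mem_filter.1 hz).2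
        have e2 := (mem_filter.1 hw).2
        simp only at h
        refine Prod.ext (by omega) (by omega)
      · intro z hz
        have := (mem_filter.1 (mem_filter.1 hz).1).2.1
        omega
      · intro z hz
        exact (mem_filter.1 (mem_filter.1 hz).1).2.2
    exact_mod_cast this
  have h4 : ∑ z ∈ Z, ρ z.2 ^ 2 ≤ 2 * H * ∑ m ∈ Icc 1 M, ρ m ^ 2 := by
    rw [← sum_fiberwise_of_maps_to (s := Z) (t := Icc 1 M) (g := fun z => z.2)
      (fun z hz => (mem_product.1 (mem_filter.1 hz).1).2), mul_sum]
    refine sum_le_sum fun m _ => ?_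
    rw [sum_congr rfl (g := fun _ => ρ m ^ 2) (fun z hz => by rw [(mem_filter.1 hz).2]),
      sum_const, nsmul_eq_mul]
    gcongr
    have : (Z.filter fun z => z.2 = m).card ≤ 2 * H := by
      refine card_le_two_mul_of_abs_le (f := fun z => (z.1 : ℤ) - z.2) ?_ ?_ ?_
      · intro z hz w hw h
        have e1 := (mem_filter.1 hz).2
        have e2 := (mem_filter.1 hw).2
        simp only at h
        refine Prod.ext (by omega) (by omega)
      · intro z hz
        have := (mem_filter.1 (mem_filter.1 hz).1).2.1
        omega
      · intro z hz
        exact (mem_filter.1 (mem_filter.1 hz).1).2.2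
    exact_mod_cast this
  have h5 := sum_rootCount_sq_le (M := M) hcop hT
  calc ((closePairs r j M H).card : ℝ) ≤ ∑ z ∈ Z, (ρ z.1 ^ 2 + ρ z.2 ^ 2) / 2 := by
        rw [h1]; push_cast; exact sum_le_sum h2
    _ = (∑ z ∈ Z, ρ z.1 ^ 2 + ∑ z ∈ Z, ρ z.2 ^ 2) / 2 := by rw [← sum_div, sum_add_distrib]
    _ ≤ 2 * H * ∑ m ∈ Icc 1 M, ρ m ^ 2 := by linarith
    _ ≤ 2 * H * (16 * T ^ 3 * M) := by gcongr
    _ = _ := by ring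

theorem closePairs_diff_dvd {r j M H : ℕ} [NeZero r] {p : (ℕ × ZMod r) × (ℕ × ZMod r)}
    (hp : p ∈ closePairs r j M H) {a : ZMod r} (ha : pairDiff p = a) :
    (r : ℤ) ∣ (a.val : ℤ) * (2 * p.1.2.val - a.val) - j * ((p.1.1 : ℤ) - p.2.1) := by
  obtain ⟨⟨h1, h2⟩, -⟩ := mem_closePairs.1 hp
  have h1 := (mem_rootPts.1 h1).2
  have h2 := (mem_rootPts.1 h2).2
  rw [← ZMod.intCast_zmod_eq_zero_iff_dvd]
  push_cast at h1 h2 ⊢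
  simp only [ZMod.natCast_zmod_val]
  rw [← ha, pairDiff]
  linear_combination h1 - h2

theorem gcd_dvd_closePairs {r j M H : ℕ} [NeZero r] (hcop : Nat.Coprime r j)
    {p : (ℕ × ZMod r) × (ℕ × ZMod r)}
    (hp : p ∈ closePairs r j M H) {a : ZMod r} (ha : pairDiff p = a) :
    ((Nat.gcd a.val r : ℕ) : ℤ) ∣ (p.1.1 : ℤ) - p.2.1 := by
  have h := closePairs_diff_dvd hp ha
  have hg : ((Nat.gcd a.val r : ℕ) : ℤ) ∣ r := Int.natCast_dvd_natCast.2 (Nat.gcd_dvd_right _ _)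
  have hg' : ((Nat.gcd a.val r : ℕ) : ℤ) ∣ a.val := Int.natCast_dvd_natCast.2 (Nat.gcd_dvd_left _ _)
  refine dvd_of_dvd_coprime_mul hcop (Nat.gcd_dvd_right _ _) ?_
  have := dvd_sub (hg'.mul_right (2 * p.1.2.val - a.val)) (hg.trans h)
  simpa using this

/-- Two pairs with the same difference of roots and the same difference of squares. -/
theorem div_gcd_dvd_closePairs {r j M H : ℕ} [NeZero r]
    {p q : (ℕ × ZMod r) × (ℕ × ZMod r)} (hp : p ∈ closePairs r j M H)
    (hq : q ∈ closePairs r j M H) {a : ZMod r} (hpa : pairDiff p = a) (hqa : pairDiff q = a)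
    (h : (p.1.1 : ℤ) - p.2.1 = (q.1.1 : ℤ) - q.2.1) :
    ((r / Nat.gcd (2 * a.val) r : ℕ) : ℤ) ∣ (p.1.2.val : ℤ) - q.1.2.val := by
  have h1 := closePairs_diff_dvd hp hpa
  have h2 := closePairs_diff_dvd hq hqa
  rw [h] at h1
  have h3 : (r : ℤ) ∣ ((2 * a.val : ℕ) : ℤ) * ((p.1.2.val : ℤ) - q.1.2.val) := by
    have := dvd_sub h1 h2
    exact this.trans (dvd_of_eq (by push_cast; ring))
  have := div_gcd_dvd_of_dvd_mul (Nat.pos_of_ne_zero (NeZero.ne r)) h3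
  rwa [Int.gcd_natCast_natCast] at this

theorem closePairs_eq_of_fst {r j M H : ℕ} [NeZero r] (hcop : Nat.Coprime r j) (hM : M ≤ r)
    {p q : (ℕ × ZMod r) × (ℕ × ZMod r)} (hp : p ∈ closePairs r j M H)
    (hq : q ∈ closePairs r j M H) (hpq : pairDiff p = pairDiff q) (h : p.1.2 = q.1.2) : p = q := by
  have hp' := (mem_closePairs.1 hp).1
  have hq' := (mem_closePairs.1 hq).1
  refine Prod.ext (rootPts_eq_of_snd_eq hcop hM hp'.1 hq'.1 h)
    (rootPts_eq_of_snd_eq hcop hM hp'.2 hq'.2 ?_)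
  rw [pairDiff, pairDiff, h] at hpq
  exact sub_right_injective hpq

/-- With g = gcd(a, r), the gap m₁ - m₂ is a nonzero multiple of g, leaving 2H/g choices. Each gap
fixes x₁ modulo r/gcd(2a, r), leaving at most 2g roots, and g cancels. -/
theorem card_closePairs_diff_le {r j M H : ℕ} [NeZero r] (hcop : Nat.Coprime r j) (hM : M ≤ r)
    (a : ZMod r) : ((closePairs r j M H).filter fun p => pairDiff p = a).card ≤ 4 * H := by
  have hr : 0 < r := Nat.pos_of_ne_zero (NeZero.ne r)
  set S := (closePairs r j M H).filter fun p => pairDiff p = a with hS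
  set g := Nat.gcd a.val r with hg
  have hg0 : 0 < g := Nat.gcd_pos_of_pos_right _ hr
  have hSm : ∀ p ∈ S, p ∈ closePairs r j M H ∧ pairDiff p = a := fun p hp => mem_filter.1 hp
  have himg : (S.image fun p => (p.1.1 : ℤ) - p.2.1).card ≤ 2 * (H / g) := by
    refine card_le_two_mul_of_abs_le (f := fun h => h / g) ?_ ?_ ?_
    · intro x hx y hy h
      simp only [coe_image, Set.mem_image, mem_coe] at hx hy
      obtain ⟨p, hp, rfl⟩ := hx
      obtain ⟨q, hq, rfl⟩ := hy
      have d1 := gcd_dvd_closePairs hcop (hSm p hp).1 (hSm p hp).2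
      have d2 := gcd_dvd_closePairs hcop (hSm q hq).1 (hSm q hq).2
      rw [← Int.ediv_mul_cancel d1, ← Int.ediv_mul_cancel d2]
      exact congrArg (· * (g : ℤ)) h
    · intro x hx
      obtain ⟨p, hp, rfl⟩ := mem_image.1 hx
      obtain ⟨k, hk⟩ := gcd_dvd_closePairs hcop (hSm p hp).1 (hSm p hp).2
      have hne := (mem_closePairs.1 (hSm p hp).1).2.1
      rw [hk, Int.mul_ediv_cancel_left _ (by exact_mod_cast hg0.ne')]
      rintro rfl
      omega
    · intro x hx
      obtain ⟨p, hp, rfl⟩ := mem_image.1 hx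
      obtain ⟨k, hk⟩ := gcd_dvd_closePairs hcop (hSm p hp).1 (hSm p hp).2
      have hle := (mem_closePairs.1 (hSm p hp).1).2.2
      have hg0' : (0 : ℤ) < g := by exact_mod_cast hg0
      rw [hk] at hle ⊢
      rw [Int.mul_ediv_cancel_left _ hg0'.ne']
      rw [abs_mul, abs_of_pos hg0'] at hle
      push_cast
      rw [Int.le_ediv_iff_mul_le hg0']
      linarith
  have hfib : ∀ h ∈ S.image (fun p => (p.1.1 : ℤ) - p.2.1),
      (S.filter fun p => (p.1.1 : ℤ) - p.2.1 = h).card ≤ 2 * g := by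
    intro h _
    set g' := Nat.gcd (2 * a.val) r with hg'
    have hg'0 : 0 < g' := Nat.gcd_pos_of_pos_right _ hr
    have hg'r : g' ∣ r := Nat.gcd_dvd_right _ _
    have hq0 : 0 < r / g' := Nat.div_pos (Nat.le_of_dvd hr hg'r) hg'0
    have h1 := card_le_of_dvd_sub (q := r / g') (A := 0) (L := r - 1)
      (S := (S.filter fun p => (p.1.1 : ℤ) - p.2.1 = h).image fun p => ((p.1.2.val : ℕ) : ℤ)) hq0
      (by
        intro x hx
        obtain ⟨p, -, rfl⟩ := mem_image.1 hx
        exact val_mem_interval _)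
      (by
        intro x hx y hy
        obtain ⟨p, hp, rfl⟩ := mem_image.1 hx
        obtain ⟨q, hq, rfl⟩ := mem_image.1 hy
        obtain ⟨hp1, hp2⟩ := mem_filter.1 hp
        obtain ⟨hq1, hq2⟩ := mem_filter.1 hq
        exact div_gcd_dvd_closePairs (hSm p hp1).1 (hSm q hq1).1 (hSm p hp1).2 (hSm q hq1).2
          (hp2.trans hq2.symm))
    rw [card_image_of_injOn] at h1
    -- Residues fill an interval of length r - 1 rather than r; the strict inequality absorbs the +1
    -- in `h1`.
    · have h2 : (r - 1) / (r / g') < g' := by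
        rw [Nat.div_lt_iff_lt_mul hq0, Nat.mul_div_cancel' hg'r]
        omega
      have h3 : g' ≤ 2 * g := by
        refine Nat.le_of_dvd (by omega) ?_
        rw [hg, ← Nat.gcd_mul_left]
        exact Nat.gcd_dvd_gcd_of_dvd_right _ (dvd_mul_left _ _)
      omega
    · intro p hp q hq hpq
      obtain ⟨hp1, hp2⟩ := mem_filter.1 hp
      obtain ⟨hq1, hq2⟩ := mem_filter.1 hq
      exact closePairs_eq_of_fst hcop hM (hSm p hp1).1 (hSm q hq1).1
        ((hSm p hp1).2.trans (hSm q hq1).2.symm) (val_injective_int hpq)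
  rw [card_eq_sum_card_image (fun p => (p.1.1 : ℤ) - p.2.1) S]
  calc _ ≤ (S.image fun p => (p.1.1 : ℤ) - p.2.1).card * (2 * g) :=
        (sum_le_card_nsmul _ _ _ hfib).trans (by simp)
    _ ≤ 2 * (H / g) * (2 * g) := by gcongr
    _ = 4 * (H / g * g) := by ring
    _ ≤ 4 * H := by gcongr; exact Nat.div_mul_le_self _ _

/-! ### Energies of fibres in a finite group. -/

section Energy

variable {α G : Type*} [Fintype G] [DecidableEq G]

/-- The number of pairs of elements of `S` with the same value of `δ`. -/
def fiberEnergy (S : Finset α) (δ : α → G) : ℕ := ∑ a : G, (S.filter fun p => δ p = a).card ^ 2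

theorem card_filter_eq_add [AddCommGroup G] (S : Finset α) (δ : α → G) (t : G) :
    ((S ×ˢ S).filter fun p => δ p.1 = δ p.2 + t).card =
      ∑ a : G, (S.filter fun p => δ p = a).card * (S.filter fun p => δ p = a - t).card := by
  rw [card_eq_sum_card_fiberwise (f := fun p => δ p.1) (t := univ) (fun _ _ => by simp)]
  refine sum_congr rfl fun a _ => ?_
  rw [← card_product]
  congr 1
  ext ⟨p, q⟩
  simp only [mem_filter, mem_product]
  constructor
  · rintro ⟨⟨⟨h1, h2⟩, h3⟩, h4⟩
    exact ⟨⟨h1, h4⟩, h2, by rw [← h4, h3]; abel⟩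
  · rintro ⟨⟨h1, h4⟩, h2, h3⟩
    exact ⟨⟨⟨h1, h2⟩, by rw [h4, h3]; abel⟩, h4⟩

theorem card_filter_eq [AddCommGroup G] (S : Finset α) (δ : α → G) :
    ((S ×ˢ S).filter fun p => δ p.1 = δ p.2).card = fiberEnergy S δ := by
  have := card_filter_eq_add S δ 0
  simp only [add_zero, sub_zero] at this
  rw [this, fiberEnergy]
  exact sum_congr rfl fun a _ => (sq _).symm

/-- A correlation of the fibre counts with a translate of themselves is largest at shift zero, by
2xy ≤ x² + y² and translation invariance. -/
theorem card_filter_eq_add_le [AddCommGroup G] (S : Finset α) (δ : α → G) (t : G) :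
    ((S ×ˢ S).filter fun p => δ p.1 = δ p.2 + t).card ≤ fiberEnergy S δ := by
  rw [card_filter_eq_add]
  set n : G → ℕ := fun a => (S.filter fun p => δ p = a).card with hn
  have h1 : ∑ a : G, n (a - t) ^ 2 = ∑ a : G, n a ^ 2 :=
    Equiv.sum_comp (Equiv.subRight t) fun a => n a ^ 2
  have h2 : 2 * ∑ a : G, n a * n (a - t) ≤ ∑ a : G, n a ^ 2 + ∑ a : G, n (a - t) ^ 2 := by
    rw [mul_sum, ← sum_add_distrib]
    refine sum_le_sum fun a _ => ?_
    have := two_mul_le_add_sq (n a) (n (a - t))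
    linarith
  rw [h1] at h2
  change ∑ a : G, n a * n (a - t) ≤ ∑ a : G, n a ^ 2
  omega

theorem card_filter_add_eq_add_le [DecidableEq α] [AddCommGroup G] (S : Finset α) (δ : α → G) :
    (((S ×ˢ S) ×ˢ (S ×ˢ S)).filter
      fun p => δ p.1.1 + δ p.1.2 = δ p.2.1 + δ p.2.2).card ≤ S.card ^ 2 * fiberEnergy S δ := by
  rw [card_eq_sum_card_fiberwise (f := fun p => (p.1.2, p.2.2)) (t := S ×ˢ S)
    (fun p hp => by
      simp only [coe_filter, Set.mem_ofPred_eq, mem_product] at hp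
      simp [hp.1.1.2, hp.1.2.2])]
  refine (sum_le_card_nsmul _ _ (fiberEnergy S δ) ?_).trans (by simp [sq])
  rintro ⟨b, d⟩ _
  refine le_trans ?_ (card_filter_eq_add_le S δ (δ d - δ b))
  refine card_le_card_of_injOn (fun p => (p.1.1, p.2.1)) ?_ ?_
  · rintro ⟨⟨p, p'⟩, q, q'⟩ hp
    simp only [coe_filter, Set.mem_ofPred_eq, mem_product, mem_filter, Prod.mk.injEq] at hp ⊢
    obtain ⟨⟨⟨⟨h1, h2⟩, h3, h4⟩, h5⟩, rfl, rfl⟩ := hp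
    refine ⟨⟨h1, h3⟩, ?_⟩
    rw [← add_sub_assoc, ← h5]; abel
  · rintro ⟨⟨p, p'⟩, q, q'⟩ hp ⟨⟨u, u'⟩, v, v'⟩ hu h
    simp only [coe_filter, Set.mem_ofPred_eq, Prod.mk.injEq] at hp hu h ⊢
    exact ⟨⟨h.1, hp.2.1.trans hu.2.1.symm⟩, h.2, hp.2.2.trans hu.2.2.symm⟩

theorem fiberEnergy_le_mul_card {S : Finset α} {δ : α → G} {B : ℕ}
    (hB : ∀ a, (S.filter fun p => δ p = a).card ≤ B) : fiberEnergy S δ ≤ B * S.card := by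
  rw [card_eq_sum_card_fiberwise (f := δ) (t := univ) (fun _ _ => by simp), mul_sum, fiberEnergy]
  refine sum_le_sum fun a _ => ?_
  rw [sq]
  exact Nat.mul_le_mul_right _ (hB a)

/-- Cauchy–Schwarz over the classes of κ. It serves twice: for the common factor f and for the cells
of `tot`. -/
theorem fiberEnergy_le_card_mul_sum {ι : Type*} [DecidableEq ι] {S : Finset α} {δ : α → G}
    {K : Finset ι} {κ : α → ι} (hκ : ∀ p ∈ S, κ p ∈ K) :
    fiberEnergy S δ ≤ K.card * ∑ k ∈ K, fiberEnergy (S.filter fun p => κ p = k) δ := by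
  simp only [fiberEnergy]
  rw [sum_comm, mul_sum]
  refine sum_le_sum fun a _ => ?_
  rw [card_eq_sum_card_fiberwise (f := κ) (t := K)
    (fun p hp => hκ p (mem_filter.1 hp).1)]
  refine sq_sum_le_card_mul_sum_sq.trans (le_of_eq ?_)
  congr 1
  refine sum_congr rfl fun k _ => ?_
  simp only [filter_filter, and_comm]

end Energy

/-! ### Reduction to primitive pairs. -/

/-- The pairs of points without a common factor `e > 1` of the roots with `e ^ 2 ∣ r`. -/
def primPairs (r j M H : ℕ) [NeZero r] : Finset ((ℕ × ZMod r) × (ℕ × ZMod r)) :=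
  (closePairs r j M H).filter fun p =>
    ∀ e ∈ r.divisors, e * e ∣ r → e ∣ p.1.2.val → e ∣ p.2.2.val → e = 1

/-- The common factors `f` of the roots of a pair with `f ^ 2 ∣ r`. -/
def commonFactors {r : ℕ} (p : (ℕ × ZMod r) × (ℕ × ZMod r)) : Finset ℕ :=
  r.divisors.filter fun f => f * f ∣ r ∧ f ∣ p.1.2.val ∧ f ∣ p.2.2.val

/-- The largest common factor `f` of the roots of a pair with `f ^ 2 ∣ r`. -/
def maxFactor {r : ℕ} (p : (ℕ × ZMod r) × (ℕ × ZMod r)) : ℕ := (commonFactors p).sup id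

theorem maxFactor_mem {r : ℕ} [NeZero r] (p : (ℕ × ZMod r) × (ℕ × ZMod r)) :
    maxFactor p ∈ commonFactors p := by
  have hne : (commonFactors p).Nonempty := ⟨1, by simp [commonFactors, NeZero.ne r]⟩
  obtain ⟨i, hi, h⟩ := exists_mem_eq_sup (commonFactors p) hne id
  rw [maxFactor, h]
  exact hi

theorem le_maxFactor {r : ℕ} {p : (ℕ × ZMod r) × (ℕ × ZMod r)} {f : ℕ}
    (hf : f ∈ commonFactors p) : f ≤ maxFactor p := le_sup (f := id) hf

/-- Division of a point by a common factor. -/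
def divPt {r : ℕ} (R f : ℕ) (p : ℕ × ZMod r) : ℕ × ZMod R := (p.1 / (f * f), ((p.2.val / f : ℕ) : ZMod R))

section Reduction

variable {r R j M H f : ℕ} [NeZero r]

theorem dvd_fst_of_dvd_val (hcop : Nat.Coprime r j) (hr : r = f * f * R) {p : ℕ × ZMod r}
    (hp : p ∈ rootPts r j M) (hf : f ∣ p.2.val) : f * f ∣ p.1 := by
  have h := rootPts_sq_sub_dvd hp
  have hfr : f * f ∣ r := hr ▸ dvd_mul_right _ _
  have h1 : ((f * f : ℕ) : ℤ) ∣ (p.2.val : ℤ) ^ 2 := by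
    rw [sq]; push_cast
    exact mul_dvd_mul (Int.natCast_dvd_natCast.2 hf) (Int.natCast_dvd_natCast.2 hf)
  have h2 := dvd_sub h1 ((Int.natCast_dvd_natCast.2 hfr).trans h)
  have h3 : ((f * f : ℕ) : ℤ) ∣ j * (p.1 : ℤ) := h2.trans (dvd_of_eq (by ring))
  exact_mod_cast dvd_of_dvd_coprime_mul hcop hfr h3

theorem divPt_mem [NeZero R] (hcop : Nat.Coprime r j) (hr : r = f * f * R) {p : ℕ × ZMod r}
    (hp : p ∈ rootPts r j M) (hf : f ∣ p.2.val) :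
    divPt R f p ∈ rootPts R j (M / (f * f)) := by
  have hr0 : 0 < r := Nat.pos_of_ne_zero (NeZero.ne r)
  have hff0 : 0 < f * f := Nat.pos_of_ne_zero fun h => by rw [h, zero_mul] at hr; omega
  obtain ⟨n, hn⟩ := dvd_fst_of_dvd_val hcop hr hp hf
  obtain ⟨k, hk⟩ := hf
  have h := rootPts_sq_sub_dvd hp
  have hp1 := (mem_rootPts.1 hp).1
  have hf0 : 0 < f := Nat.pos_of_mul_pos_left hff0
  rw [mem_rootPts, divPt]
  simp only [hk, hn, Nat.mul_div_cancel_left _ hf0, Nat.mul_div_cancel_left _ hff0]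
  refine ⟨⟨?_, ?_⟩, ?_⟩
  · rcases Nat.eq_zero_or_pos n with rfl | h
    · simp at hn; omega
    · exact h
  · rw [Nat.le_div_iff_mul_le hff0, mul_comm, ← hn]; exact hp1.2
  · rw [← sub_eq_zero]
    have : (R : ℤ) ∣ (k : ℤ) ^ 2 - j * n := by
      have hff0' : ((f * f : ℕ) : ℤ) ≠ 0 := by exact_mod_cast hff0.ne'
      refine (mul_dvd_mul_iff_left hff0').1 ?_
      rw [hk, hn] at h
      have h' : ((f * f : ℕ) : ℤ) * (R : ℤ) = r := by exact_mod_cast hr.symm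
      rw [h']
      exact h.trans (dvd_of_eq (by push_cast; ring))
    rw [← ZMod.intCast_zmod_eq_zero_iff_dvd] at this
    push_cast at this ⊢
    exact this

/-- The quotient x/f lies in [0, fR) with prescribed residue modulo R, and x determines m because M
≤ r. -/
theorem card_divPt_fiber_le [NeZero R] (hcop : Nat.Coprime r j) (hr : r = f * f * R) (hM : M ≤ r)
    (u : ℕ × ZMod R) :
    ((rootPts r j M).filter fun p => f ∣ p.2.val ∧ divPt R f p = u).card ≤ f := by
  have hr0 : 0 < r := Nat.pos_of_ne_zero (NeZero.ne r)
  have hR0 : 0 < R := Nat.pos_of_ne_zero (NeZero.ne R)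
  have hff0 : 0 < f * f := Nat.pos_of_ne_zero fun h => by rw [h, zero_mul] at hr; omega
  have hf0 : 0 < f := Nat.pos_of_mul_pos_left hff0
  set S := (rootPts r j M).filter fun p => f ∣ p.2.val ∧ divPt R f p = u with hS
  have hfR : 0 < f * R := Nat.mul_pos hf0 hR0
  have h1 := card_le_of_dvd_sub (q := R) (A := 0) (L := f * R - 1)
    (S := S.image fun p => ((p.2.val / f : ℕ) : ℤ)) hR0
    (by
      intro x hx
      obtain ⟨p, hp, rfl⟩ := mem_image.1 hx
      have h1 := ZMod.val_lt p.2
      have h2 : p.2.val / f < f * R := by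
        rw [Nat.div_lt_iff_lt_mul hf0]
        calc _ < r := h1
          _ = _ := by rw [hr]; ring
      have h3 : (0 : ℤ) ≤ ((p.2.val / f : ℕ) : ℤ) := Int.natCast_nonneg _
      have h4 : ((p.2.val / f : ℕ) : ℤ) < ((f * R : ℕ) : ℤ) := Int.ofNat_lt.2 h2
      push_cast [Nat.cast_sub hfR] at h3 h4 ⊢
      constructor <;> linarith)
    (by
      intro x hx y hy
      obtain ⟨p, hp, rfl⟩ := mem_image.1 hx
      obtain ⟨q, hq, rfl⟩ := mem_image.1 hy
      have e := ((mem_filter.1 hp).2.2).trans ((mem_filter.1 hq).2.2).symm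
      have e2 := congrArg Prod.snd e
      simp only [divPt] at e2
      rw [← ZMod.intCast_zmod_eq_zero_iff_dvd, Int.cast_sub, Int.cast_natCast, Int.cast_natCast,
        e2, sub_self])
  rw [card_image_of_injOn] at h1
  · have h2 : (f * R - 1) / R < f := by
      rw [Nat.div_lt_iff_lt_mul hR0]; omega
    omega
  · intro p hp q hq h
    obtain ⟨hp1, hp2, -⟩ := mem_filter.1 hp
    obtain ⟨hq1, hq2, -⟩ := mem_filter.1 hq
    refine rootPts_eq_of_snd_eq hcop hM hp1 hq1 (ZMod.val_injective r ?_)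
    have h' : p.2.val / f = q.2.val / f := Int.ofNat_injective h
    rw [← Nat.div_mul_cancel hp2, ← Nat.div_mul_cancel hq2, h']

theorem divPt_pair_mem [NeZero R] (hcop : Nat.Coprime r j) (hr : r = f * f * R)
    {p : (ℕ × ZMod r) × (ℕ × ZMod r)} (hp : p ∈ closePairs r j M H) (hf : maxFactor p = f) :
    (divPt R f p.1, divPt R f p.2) ∈ primPairs R j (M / (f * f)) (H / (f * f)) := by
  have hr0 : 0 < r := Nat.pos_of_ne_zero (NeZero.ne r)
  have hR0 : 0 < R := Nat.pos_of_ne_zero (NeZero.ne R)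
  have hff0 : 0 < f * f := Nat.pos_of_ne_zero fun h => by rw [h, zero_mul] at hr; omega
  have hf0 : 0 < f := Nat.pos_of_mul_pos_left hff0
  have hmem := hf ▸ maxFactor_mem p
  obtain ⟨hfr, hffr, hf1, hf2⟩ := mem_filter.1 hmem
  obtain ⟨⟨hp1, hp2⟩, hne, hle⟩ := mem_closePairs.1 hp
  obtain ⟨n1, hn1⟩ := dvd_fst_of_dvd_val hcop hr hp1 hf1
  obtain ⟨n2, hn2⟩ := dvd_fst_of_dvd_val hcop hr hp2 hf2
  rw [primPairs, mem_filter, mem_closePairs]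
  refine ⟨⟨⟨divPt_mem hcop hr hp1 hf1, divPt_mem hcop hr hp2 hf2⟩, ?_, ?_⟩, ?_⟩
  · simp only [divPt, hn1, hn2, Nat.mul_div_cancel_left _ hff0]
    rintro rfl
    exact hne (hn1.trans hn2.symm)
  · simp only [divPt, hn1, hn2, Nat.mul_div_cancel_left _ hff0]
    rw [hn1, hn2] at hle
    have hff0' : (0 : ℤ) < ((f * f : ℕ) : ℤ) := by exact_mod_cast hff0
    rw [Int.natCast_div, Int.le_ediv_iff_mul_le hff0', ← abs_of_pos hff0', ← abs_mul]
    refine le_trans (le_of_eq ?_) hle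
    congr 1
    push_cast
    ring
  -- A common factor e left after division would make ef a common factor of the original roots with
  -- (ef)² ∣ r; maximality of f gives e = 1.
  · intro e _ heR he1 he2
    have hdvd : ∀ x : ZMod r, f ∣ x.val → e ∣ ((x.val / f : ℕ) : ZMod R).val → e * f ∣ x.val := by
      intro x hx h
      rw [ZMod.val_natCast] at h
      have h1 : e ∣ x.val / f := (Nat.dvd_mod_iff ((dvd_mul_right _ _).trans heR)).1 h
      obtain ⟨c, hc⟩ := h1
      refine ⟨c, ?_⟩
      rw [← Nat.div_mul_cancel hx, hc]; ring
    have hefr : (e * f) * (e * f) ∣ r := by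
      rw [hr]
      calc (e * f) * (e * f) = f * f * (e * e) := by ring
        _ ∣ _ := mul_dvd_mul_left _ heR
    have hm : e * f ∈ commonFactors p := by
      rw [commonFactors, mem_filter, Nat.mem_divisors]
      exact ⟨⟨(dvd_mul_right _ _).trans hefr, hr0.ne'⟩, hefr, hdvd _ hf1 he1, hdvd _ hf2 he2⟩
    have hle' := le_maxFactor hm
    rw [hf] at hle'
    have he0 : 0 < e := Nat.pos_of_ne_zero fun h => by
      rw [h] at heR; simp at heR; omega
    have : e * f ≤ 1 * f := by simpa using hle'
    have := Nat.le_of_mul_le_mul_right this hf0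
    omega

theorem pairDiff_divPt (hr : r = f * f * R) {p q : (ℕ × ZMod r) × (ℕ × ZMod r)}
    (hp1 : f ∣ p.1.2.val) (hp2 : f ∣ p.2.2.val) (hq1 : f ∣ q.1.2.val) (hq2 : f ∣ q.2.2.val)
    (h : pairDiff p = pairDiff q) :
    pairDiff (divPt R f p.1, divPt R f p.2) = pairDiff (divPt R f q.1, divPt R f q.2) := by
  have hr0 : 0 < r := Nat.pos_of_ne_zero (NeZero.ne r)
  have hff0 : 0 < f * f := Nat.pos_of_ne_zero fun h => by rw [h, zero_mul] at hr; omega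
  have hf0 : 0 < f := Nat.pos_of_mul_pos_left hff0
  obtain ⟨a, ha⟩ := hp1
  obtain ⟨b, hb⟩ := hp2
  obtain ⟨c, hc⟩ := hq1
  obtain ⟨d, hd⟩ := hq2
  have h1 : (r : ℤ) ∣ ((p.1.2.val : ℤ) - p.2.2.val) - (q.1.2.val - q.2.2.val) := by
    rw [← ZMod.intCast_zmod_eq_zero_iff_dvd]
    push_cast
    simp only [ZMod.natCast_zmod_val]
    rw [sub_eq_zero]; exact h
  rw [ha, hb, hc, hd] at h1
  have h2 : (R : ℤ) ∣ ((a : ℤ) - b) - (c - d) := by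
    have hf0' : (f : ℤ) ≠ 0 := by exact_mod_cast hf0.ne'
    refine (mul_dvd_mul_iff_left hf0').1 ?_
    have h3 : (f : ℤ) * R ∣ r := ⟨f, by rw [hr]; push_cast; ring⟩
    exact (h3.trans h1).trans (dvd_of_eq (by push_cast; ring))
  rw [← ZMod.intCast_zmod_eq_zero_iff_dvd] at h2
  simp only [pairDiff, divPt, ha, hb, hc, hd, Nat.mul_div_cancel_left _ hf0]
  push_cast at h2
  exact sub_eq_zero.1 h2

/-- Division by f preserves equality of differences, and each of the four points involved has at
most f preimages. -/
theorem fiberEnergy_maxFactor_le [NeZero R] (hcop : Nat.Coprime r j) (hr : r = f * f * R) (hM : M ≤ r) :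
    fiberEnergy ((closePairs r j M H).filter fun p => maxFactor p = f) pairDiff ≤
      f ^ 4 * fiberEnergy (primPairs R j (M / (f * f)) (H / (f * f))) pairDiff := by
  rw [← card_filter_eq, ← card_filter_eq]
  refine card_le_mul_card_image_of_maps_to
    (f := fun p => ((divPt R f p.1.1, divPt R f p.1.2), (divPt R f p.2.1, divPt R f p.2.2))) ?_ _ ?_
  · rintro ⟨p, q⟩ hpq
    obtain ⟨hS, hd⟩ := mem_filter.1 hpq
    obtain ⟨hp, hq⟩ := mem_product.1 hS
    obtain ⟨hp, hpf⟩ := mem_filter.1 hp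
    obtain ⟨hq, hqf⟩ := mem_filter.1 hq
    rw [mem_filter, mem_product]
    obtain ⟨-, -, hp1, hp2⟩ := mem_filter.1 (hpf ▸ maxFactor_mem p)
    obtain ⟨-, -, hq1, hq2⟩ := mem_filter.1 (hqf ▸ maxFactor_mem q)
    exact ⟨⟨divPt_pair_mem hcop hr hp hpf, divPt_pair_mem hcop hr hq hqf⟩,
      pairDiff_divPt hr hp1 hp2 hq1 hq2 hd⟩
  · rintro ⟨⟨u1, u2⟩, v1, v2⟩ _
    set F : ℕ × ZMod R → Finset (ℕ × ZMod r) := fun u =>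
      (rootPts r j M).filter fun p => f ∣ p.2.val ∧ divPt R f p = u with hF
    have hFc : ∀ u, (F u).card ≤ f := card_divPt_fiber_le hcop hr hM
    calc _ ≤ ((F u1 ×ˢ F u2) ×ˢ (F v1 ×ˢ F v2)).card := by
          refine card_le_card ?_
          rintro ⟨⟨p1, p2⟩, q1, q2⟩ hpq
          simp only [mem_filter, mem_product, mem_closePairs, Prod.mk.injEq] at hpq
          obtain ⟨⟨⟨⟨⟨⟨p1m, p2m⟩, -⟩, pf⟩, ⟨⟨q1m, q2m⟩, -⟩, qf⟩, -⟩, ⟨e1, e2⟩, e3, e4⟩ := hpq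
          obtain ⟨-, -, hp1, hp2⟩ := mem_filter.1 (pf ▸ maxFactor_mem (p1, p2))
          obtain ⟨-, -, hq1, hq2⟩ := mem_filter.1 (qf ▸ maxFactor_mem (q1, q2))
          simp only [hF, mem_product, mem_filter]
          exact ⟨⟨⟨p1m, hp1, e1⟩, p2m, hp2, e2⟩, ⟨q1m, hq1, e3⟩, q2m, hq2, e4⟩
      _ = ((F u1).card * (F u2).card) * ((F v1).card * (F v2).card) := by simp only [card_product]
      _ ≤ (f * f) * (f * f) := by gcongr <;> exact hFc _
      _ = f ^ 4 := by ring

end Reduction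

/-! ### Geometry of the points (gap², tot) in a cell. -/

/-- The difference of the first coordinates of a pair. -/
def gap {r : ℕ} (p : (ℕ × ZMod r) × (ℕ × ZMod r)) : ℤ := (p.1.1 : ℤ) - p.2.1

/-- The sum of the first coordinates of a pair. -/
def tot {r : ℕ} (p : (ℕ × ZMod r) × (ℕ × ZMod r)) : ℕ := p.1.1 + p.2.1

section Cell

variable {r j M H V : ℕ} [NeZero r] {a : ZMod r} {p q w : (ℕ × ZMod r) × (ℕ × ZMod r)}

theorem abs_gap_le (hp : p ∈ closePairs r j M H) : |gap p| ≤ H := (mem_closePairs.1 hp).2.2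

theorem gap_ne_zero (hp : p ∈ closePairs r j M H) : gap p ≠ 0 := by
  have := (mem_closePairs.1 hp).2.1
  rw [gap]; omega

theorem abs_gap_sq_sub_lt (hp : p ∈ closePairs r j M H) (hq : q ∈ closePairs r j M H) :
    |gap p ^ 2 - gap q ^ 2| < (H : ℤ) ^ 2 := by
  have h1 := sq_le_sq.2 ((abs_gap_le hp).trans (le_abs_self _))
  have h2 := sq_le_sq.2 ((abs_gap_le hq).trans (le_abs_self _))
  have h3 := pow_pos (abs_pos.2 (gap_ne_zero hp)) 2
  have h4 := pow_pos (abs_pos.2 (gap_ne_zero hq)) 2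
  rw [sq_abs] at h3 h4
  rw [abs_lt]
  constructor <;> linarith

/-- Each pair satisfies j²h² = a²(2js - a²) modulo r; subtracting two such relations removes a⁴, and
one factor j cancels. -/
theorem gap_sq_mul_sub_dvd (hcop : Nat.Coprime r j) (hp : p ∈ closePairs r j M H)
    (hq : q ∈ closePairs r j M H) (hpa : pairDiff p = a) (hqa : pairDiff q = a) :
    (r : ℤ) ∣ j * (gap p ^ 2 - gap q ^ 2) - 2 * (a.val : ℤ) ^ 2 * ((tot p : ℤ) - tot q) := by
  have key : ∀ p ∈ closePairs r j M H, pairDiff p = a →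
      (j : ZMod r) ^ 2 * (gap p : ZMod r) ^ 2 = a ^ 2 * (2 * j * (tot p : ZMod r) - a ^ 2) := by
    intro p hp hpa
    obtain ⟨⟨h1, h2⟩, -⟩ := mem_closePairs.1 hp
    have h1 := (mem_rootPts.1 h1).2
    have h2 := (mem_rootPts.1 h2).2
    rw [← hpa, pairDiff, gap, tot]
    push_cast at h1 h2 ⊢
    have e1 : (j : ZMod r) * (p.1.1 - p.2.1) = (p.1.2 - p.2.2) * (p.1.2 + p.2.2) := by
      linear_combination h2 - h1
    have e2 : (2 * j * (p.1.1 + p.2.1) - (p.1.2 - p.2.2) ^ 2 : ZMod r) = (p.1.2 + p.2.2) ^ 2 := by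
      linear_combination (-2) * h1 - 2 * h2
    rw [e2, ← mul_pow, e1]; ring
  refine dvd_of_dvd_coprime_mul hcop dvd_rfl ?_
  rw [← ZMod.intCast_zmod_eq_zero_iff_dvd]
  push_cast
  simp only [ZMod.natCast_zmod_val]
  linear_combination key p hp hpa - key q hq hqa

theorem gap_sq_eq_of_tot_eq (hcop : Nat.Coprime r j) (hH : H ^ 2 ≤ r)
    (hp : p ∈ closePairs r j M H)
    (hq : q ∈ closePairs r j M H) (hpa : pairDiff p = a) (hqa : pairDiff q = a)
    (h : tot p = tot q) : gap p ^ 2 - gap q ^ 2 = 0 := by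
  have h1 := gap_sq_mul_sub_dvd hcop hp hq hpa hqa
  rw [h, sub_self, mul_zero, sub_zero] at h1
  refine Int.eq_zero_of_abs_lt_dvd (dvd_of_dvd_coprime_mul hcop dvd_rfl h1) ?_
  refine (abs_gap_sq_sub_lt hp hq).trans_le ?_
  exact_mod_cast hH

/-- Two solutions of the same linear congruence have determinant divisible by r. Its size is at most
2(H² - 1)V, so it vanishes. -/
theorem gap_tot_collinear (hcop : Nat.Coprime r j) (hV : 2 * H ^ 2 * V ≤ r)
    (hp : p ∈ closePairs r j M H) (hq : q ∈ closePairs r j M H) (hw : w ∈ closePairs r j M H)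
    (hpa : pairDiff p = a) (hqa : pairDiff q = a) (hwa : pairDiff w = a)
    (hpV : |(tot p : ℤ) - tot w| ≤ V) (hqV : |(tot q : ℤ) - tot w| ≤ V) :
    (gap p ^ 2 - gap w ^ 2) * ((tot q : ℤ) - tot w) =
      (gap q ^ 2 - gap w ^ 2) * ((tot p : ℤ) - tot w) := by
  have hr : 0 < r := Nat.pos_of_ne_zero (NeZero.ne r)
  have h1 := gap_sq_mul_sub_dvd hcop hp hw hpa hwa
  have h2 := gap_sq_mul_sub_dvd hcop hq hw hqa hwa
  have u1 := abs_gap_sq_sub_lt hp hw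
  have u2 := abs_gap_sq_sub_lt hq hw
  generalize gap p ^ 2 - gap w ^ 2 = U at *
  generalize gap q ^ 2 - gap w ^ 2 = U' at *
  generalize (tot p : ℤ) - tot w = Y at *
  generalize (tot q : ℤ) - tot w = Y' at *
  have h3 : (r : ℤ) ∣ j * (U * Y' - U' * Y) :=
    (dvd_sub (h1.mul_right Y') (h2.mul_right Y)).trans (dvd_of_eq (by ring))
  refine sub_eq_zero.1 (Int.eq_zero_of_abs_lt_dvd (dvd_of_dvd_coprime_mul hcop dvd_rfl h3) ?_)
  have hV' : 2 * (H : ℤ) ^ 2 * V ≤ r := by exact_mod_cast hV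
  have hr' : (0 : ℤ) < r := by exact_mod_cast hr
  have b1 : |U * Y'| ≤ ((H : ℤ) ^ 2 - 1) * V := by
    rw [abs_mul]
    exact mul_le_mul (by linarith) hqV (abs_nonneg _) (by linarith [abs_nonneg U])
  have b2 : |U' * Y| ≤ ((H : ℤ) ^ 2 - 1) * V := by
    rw [abs_mul]
    exact mul_le_mul (by linarith) hpV (abs_nonneg _) (by linarith [abs_nonneg U'])
  have b3 : |U * Y' - U' * Y| ≤ |U * Y'| + |U' * Y| := abs_sub _ _
  rcases Nat.eq_zero_or_pos V with rfl | hV0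
  · simp only [Nat.cast_zero, mul_zero] at b1 b2
    linarith
  · have : (0 : ℤ) < V := by exact_mod_cast hV0
    nlinarith

/-- Pairs in a cell with the same gap have the same first coordinates. -/
theorem fst_eq_of_gap_eq (hcop : Nat.Coprime r j) (hV : 2 * H ^ 2 * V ≤ r)
    (hp : p ∈ closePairs r j M H) (hq : q ∈ closePairs r j M H)
    (hpa : pairDiff p = a) (hqa : pairDiff q = a)
    (hpV : |(tot p : ℤ) - tot q| ≤ V) (h : gap p = gap q) : p.1.1 = q.1.1 := by
  have hr : 0 < r := Nat.pos_of_ne_zero (NeZero.ne r)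
  -- With equal gaps the roots, hence the m₁, agree modulo r/g', where g' ≤ 2H. Distinct m₁ would
  -- differ by at least r/g', while `tot` moves by twice that difference, so r ≤ VH, against 2H²V ≤
  -- r.
  by_contra hne
  have h1 := div_gcd_dvd_closePairs hp hq hpa hqa h
  set g' := Nat.gcd (2 * a.val) r with hg'
  have hg'r : g' ∣ r := Nat.gcd_dvd_right _ _
  have hg'0 : 0 < g' := Nat.gcd_pos_of_pos_right _ hr
  have hqr : r / g' * g' = r := Nat.div_mul_cancel hg'r
  have h2 : ((r / g' : ℕ) : ℤ) ∣ (p.1.1 : ℤ) - q.1.1 := by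
    have e1 := rootPts_sq_sub_dvd (mem_closePairs.1 hp).1.1
    have e2 := rootPts_sq_sub_dvd (mem_closePairs.1 hq).1.1
    have e3 : ((r / g' : ℕ) : ℤ) ∣ r := Int.natCast_dvd_natCast.2 (Nat.div_dvd_of_dvd hg'r)
    refine dvd_of_dvd_coprime_mul hcop (Nat.div_dvd_of_dvd hg'r) ?_
    have := dvd_sub (h1.mul_right ((p.1.2.val : ℤ) + q.1.2.val)) (e3.trans (dvd_sub e1 e2))
    exact this.trans (dvd_of_eq (by ring))
  have h3 : g' ≤ 2 * H := by
    have d1 := gcd_dvd_closePairs hcop hp hpa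
    have d2 := Int.le_of_dvd (abs_pos.2 (gap_ne_zero hp)) ((dvd_abs _ _).2 d1)
    have d3 := d2.trans (abs_gap_le hp)
    have d4 : g' ∣ 2 * Nat.gcd a.val r := by
      rw [← Nat.gcd_mul_left]
      exact Nat.gcd_dvd_gcd_of_dvd_right _ (dvd_mul_left _ _)
    have d5 := Nat.le_of_dvd (Nat.mul_pos two_pos (Nat.gcd_pos_of_pos_right _ hr)) d4
    have d6 : Nat.gcd a.val r ≤ H := by exact_mod_cast d3
    omega
  have h4 : ((r / g' : ℕ) : ℤ) ≤ |(p.1.1 : ℤ) - q.1.1| := by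
    refine Int.le_of_dvd (abs_pos.2 ?_) ((dvd_abs _ _).2 h2)
    omega
  have h5 : 2 * |(p.1.1 : ℤ) - q.1.1| ≤ V := by
    rw [gap, gap] at h
    rw [tot, tot] at hpV
    have e : ((p.1.1 + p.2.1 : ℕ) : ℤ) - (q.1.1 + q.2.1 : ℕ) = 2 * ((p.1.1 : ℤ) - q.1.1) := by
      push_cast; linarith
    rw [e, abs_mul] at hpV
    simpa using hpV
  have h6 : 2 * (r / g') ≤ V := by
    have : 2 * ((r / g' : ℕ) : ℤ) ≤ V := by linarith
    exact_mod_cast this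
  have hH : 1 ≤ H := by
    rcases Nat.eq_zero_or_pos H with rfl | h
    · omega
    · exact h
  have h7 : 0 < r / g' := Nat.div_pos (Nat.le_of_dvd hr hg'r) hg'0
  have h8 : r ≤ V * H := by
    calc r = r / g' * g' := hqr.symm
      _ ≤ r / g' * (2 * H) := by gcongr
      _ = 2 * (r / g') * H := by ring
      _ ≤ V * H := by gcongr
  have h9 : 2 * H ^ 2 * V ≤ V * H := hV.trans h8
  have h10 : V * H ≤ V * H * H := Nat.le_mul_of_pos_right _ hH
  have h11 : 0 < V * H := by omega
  nlinarith

/-- Bound for the number of pairs in a cell with a given gap. -/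
theorem card_gap_fiber_le {T : ℝ} (hcop : Nat.Coprime r j) (hM : M ≤ r) (hV : 2 * H ^ 2 * V ≤ r)
    (hT : ∀ n : ℕ, 0 < n → n ≤ r → (n.divisors.card : ℝ) ≤ T)
    {S : Finset ((ℕ × ZMod r) × (ℕ × ZMod r))} (hS : S ⊆ primPairs r j M H)
    (hSa : ∀ p ∈ S, pairDiff p = a) (hSV : ∀ p ∈ S, ∀ q ∈ S, |(tot p : ℤ) - tot q| ≤ V)
    (h : ℤ) : ((S.filter fun p => gap p = h).card : ℝ) ≤ 3 * T := by
  classical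
  have hr : 0 < r := Nat.pos_of_ne_zero (NeZero.ne r)
  have hT0 : 0 ≤ T := le_trans (by positivity) (hT r hr le_rfl)
  rcases (S.filter fun p => gap p = h).eq_empty_or_nonempty with he | ⟨w, hw⟩
  · rw [he]; simpa using hT0
  obtain ⟨hwS, hwh⟩ := mem_filter.1 hw
  have hc : ∀ p ∈ S, p ∈ closePairs r j M H := fun p hp => (mem_filter.1 (hS hp)).1
  have hfst : ∀ p ∈ S.filter (fun p => gap p = h), p.1.1 = w.1.1 := by
    intro p hp
    obtain ⟨hpS, hph⟩ := mem_filter.1 hp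
    exact fst_eq_of_gap_eq hcop hV (hc p hpS) (hc w hwS) (hSa p hpS) (hSa w hwS)
      (hSV p hpS w hwS) (hph.trans hwh.symm)
  have hinj : Set.InjOn (fun p : (ℕ × ZMod r) × (ℕ × ZMod r) => p.1.2)
      (S.filter fun p => gap p = h) := by
    intro p hp q hq hpq
    obtain ⟨hpS, -⟩ := mem_filter.1 hp
    obtain ⟨hqS, -⟩ := mem_filter.1 hq
    exact closePairs_eq_of_fst hcop hM (hc p hpS) (hc q hqS)
      ((hSa p hpS).trans (hSa q hqS).symm) hpq
  have hsq : ∀ p ∈ S.filter (fun p => gap p = h),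
      (r : ℤ) ∣ (p.1.2.val : ℤ) ^ 2 - (w.1.2.val : ℤ) ^ 2 := by
    intro p hp
    have e1 := rootPts_sq_sub_dvd (mem_closePairs.1 (hc p (mem_filter.1 hp).1)).1.1
    have e2 := rootPts_sq_sub_dvd (mem_closePairs.1 (hc w hwS)).1.1
    rw [hfst p hp] at e1
    exact (dvd_sub e1 e2).trans (dvd_of_eq (by ring))
  have hmain := card_sq_eq_le (S := (S.filter fun p => gap p = h).image fun p => p.1.2)
    (z := w.1.2.val) (N := r) (T := T) (B := 2) hr le_rfl hT (by norm_num)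
    (by
      intro x hx
      obtain ⟨p, hp, rfl⟩ := mem_image.1 hx
      exact hsq p hp)
    (by
      intro x hx
      obtain ⟨p, hp, rfl⟩ := mem_image.1 hx
      obtain ⟨hpS, hph⟩ := mem_filter.1 hp
      set y := (p.1.2.val : ℤ) - (w.1.2.val : ℤ) with hy
      -- Here e divides 2x₁, and equality of the gaps also gives e ∣ 2a, hence e ∣ 2x₂. Since e² ∣
      -- r, primitivity leaves only e ≤ 2.
      set e := splitGcd r y with he
      have he1 : e * e ∣ r := splitGcd_mul_self_dvd _ _
      have her : e ∣ r := splitGcd_dvd_self _ _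
      have he2 : (e : ℤ) ∣ y := splitGcd_dvd_left _ _
      have he3 : (e : ℤ) ∣ (p.1.2.val : ℤ) + w.1.2.val :=
        splitGcd_dvd_of_dvd_mul hr ((hsq p hp).trans (dvd_of_eq (by rw [hy]; ring)))
      have he4 : (e : ℤ) ∣ 2 * p.1.2.val := (dvd_add he2 he3).trans (dvd_of_eq (by rw [hy]; ring))
      have he5 : (e : ℤ) ∣ 2 * (a.val : ℤ) := by
        have h1 := closePairs_diff_dvd (hc p hpS) (hSa p hpS)
        have h2 := closePairs_diff_dvd (hc w hwS) (hSa w hwS)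
        have h0 : (p.1.1 : ℤ) - p.2.1 = (w.1.1 : ℤ) - w.2.1 := hph.trans hwh.symm
        rw [h0] at h1
        refine splitGcd_dvd_of_dvd_mul (N := r) (y := y) hr ?_
        exact (dvd_sub h1 h2).trans (dvd_of_eq (by rw [hy]; ring))
      have he6 : (e : ℤ) ∣ 2 * p.2.2.val := by
        have h1 : (r : ℤ) ∣ 2 * p.2.2.val - (2 * p.1.2.val - 2 * a.val) := by
          rw [← ZMod.intCast_zmod_eq_zero_iff_dvd]
          push_cast
          simp only [ZMod.natCast_zmod_val]
          rw [← hSa p hpS, pairDiff]; ring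
        have h2 := dvd_add ((Int.natCast_dvd_natCast.2 her).trans h1) (dvd_sub he4 he5)
        exact h2.trans (dvd_of_eq (by ring))
      have hprim := (mem_filter.1 (hS hpS)).2
      have he4' : e ∣ 2 * p.1.2.val := by exact_mod_cast he4
      have he6' : e ∣ 2 * p.2.2.val := by exact_mod_cast he6
      have : e ≤ 2 := by
        rcases Nat.even_or_odd' e with ⟨k, hk | hk⟩
        · rw [hk] at he4' he6'
          have hke : k * k ∣ r := dvd_trans (by rw [hk]; exact ⟨4, by ring⟩) he1
          have := hprim k (Nat.mem_divisors.2 ⟨(dvd_mul_right _ _).trans hke, hr.ne'⟩) hke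
            (Nat.dvd_of_mul_dvd_mul_left two_pos he4') (Nat.dvd_of_mul_dvd_mul_left two_pos he6')
          omega
        · have hodd : Nat.Coprime e 2 := by
            rw [Nat.coprime_two_right, hk]; exact ⟨k, rfl⟩
          have := hprim e (Nat.mem_divisors.2 ⟨her, hr.ne'⟩) he1
            (hodd.dvd_of_dvd_mul_left he4') (hodd.dvd_of_dvd_mul_left he6')
          omega
      exact_mod_cast this)
  rw [card_image_of_injOn hinj, mul_div_cancel_left₀ _ (by positivity)] at hmain
  linarith

theorem card_cell_le {T : ℝ} (hcop : Nat.Coprime r j) (hM : M ≤ r) (hV : 2 * H ^ 2 * V ≤ r)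
    (hT : ∀ n : ℕ, 0 < n → n ≤ r → (n.divisors.card : ℝ) ≤ T)
    {S : Finset ((ℕ × ZMod r) × (ℕ × ZMod r))} (hS : S ⊆ primPairs r j M H)
    (hSa : ∀ p ∈ S, pairDiff p = a) (hSV : ∀ p ∈ S, ∀ q ∈ S, |(tot p : ℤ) - tot q| ≤ V) :
    (S.card : ℝ) ≤ 3 * T * (S.image gap).card := by
  rw [card_eq_sum_card_image gap S]
  push_cast
  refine (sum_le_card_nsmul _ _ (3 * T) fun h _ =>
    card_gap_fiber_le hcop hM hV hT hS hSa hSV h).trans ?_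
  rw [nsmul_eq_mul, mul_comm]

/-- The line carrying the points `(gap ^ 2, tot)` of a cell. -/
theorem exists_cell_line (hcop : Nat.Coprime r j) (hH : H ^ 2 ≤ r) (hV : 2 * H ^ 2 * V ≤ r)
    {S : Finset ((ℕ × ZMod r) × (ℕ × ZMod r))} (hS : S ⊆ closePairs r j M H)
    (hSa : ∀ p ∈ S, pairDiff p = a) (hw : w ∈ S) (hSV : ∀ p ∈ S, |(tot p : ℤ) - tot w| ≤ V)
    (hne : ∃ p ∈ S, gap p ^ 2 ≠ gap w ^ 2) :
    ∃ (u : ℕ) (v : ℤ), 0 < u ∧ u ≤ H ^ 2 ∧ v ≠ 0 ∧ |v| ≤ V ∧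
      (r : ℤ) ∣ j * ((Nat.gcd a.val r : ℕ) ^ 2 * u) - 2 * (a.val : ℤ) ^ 2 * v ∧
      ∀ p ∈ S, ∃ t : ℤ, gap p ^ 2 - gap w ^ 2 = t * ((Nat.gcd a.val r : ℕ) ^ 2 * u) ∧
        (tot p : ℤ) - tot w = t * v := by
  have hr : 0 < r := Nat.pos_of_ne_zero (NeZero.ne r)
  set g := Nat.gcd a.val r with hg
  have hg0 : 0 < g := Nat.gcd_pos_of_pos_right _ hr
  -- Lattice vectors on the common line whose first coordinate is divisible by g². The projection to
  -- the first coordinate is cyclic, and collinearity recovers the second coordinate, so a lift of a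
  -- positive generator spans all the differences from w.
  let A : AddSubgroup (ℤ × ℤ) :=
    { carrier := {x | ((r : ℤ) ∣ j * x.1 - 2 * (a.val : ℤ) ^ 2 * x.2 ∧ ((g : ℤ) ^ 2 ∣ x.1)) ∧
        ∀ p ∈ S, x.1 * ((tot p : ℤ) - tot w) = (gap p ^ 2 - gap w ^ 2) * x.2}
      zero_mem' := by simp
      add_mem' := by
        rintro x y ⟨⟨h1, h2⟩, h3⟩ ⟨⟨k1, k2⟩, k3⟩
        refine ⟨⟨(dvd_add h1 k1).trans (dvd_of_eq ?_), dvd_add h2 k2⟩, fun p hp => ?_⟩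
        · simp only [Prod.fst_add, Prod.snd_add]; ring
        · simp only [Prod.fst_add, Prod.snd_add]
          linear_combination h3 p hp + k3 p hp
      neg_mem' := by
        rintro x ⟨⟨h1, h2⟩, h3⟩
        refine ⟨⟨((dvd_neg).2 h1).trans (dvd_of_eq ?_), (dvd_neg).2 h2⟩, fun p hp => ?_⟩
        · simp only [Prod.fst_neg, Prod.snd_neg]; ring
        · simp only [Prod.fst_neg, Prod.snd_neg]
          linear_combination -(h3 p hp) }
  have hmemA : ∀ p ∈ S, ((gap p ^ 2 - gap w ^ 2, (tot p : ℤ) - tot w) : ℤ × ℤ) ∈ A := by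
    intro p hp
    refine ⟨⟨gap_sq_mul_sub_dvd hcop (hS hp) (hS hw) (hSa p hp) (hSa w hw), ?_⟩, fun q hq => ?_⟩
    · have d1 := pow_dvd_pow_of_dvd (gcd_dvd_closePairs hcop (hS hp) (hSa p hp)) 2
      have d2 := pow_dvd_pow_of_dvd (gcd_dvd_closePairs hcop (hS hw) (hSa w hw)) 2
      exact dvd_sub d1 d2
    · exact gap_tot_collinear hcop hV (hS hp) (hS hq) (hS hw) (hSa p hp) (hSa q hq) (hSa w hw)
        (hSV p hp) (hSV q hq)
  obtain ⟨d, hd⟩ := Int.subgroup_cyclic (A.map (AddMonoidHom.fst ℤ ℤ))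
  have hdvd : ∀ p ∈ S, d ∣ gap p ^ 2 - gap w ^ 2 := by
    intro p hp
    have h1 : gap p ^ 2 - gap w ^ 2 ∈ A.map (AddMonoidHom.fst ℤ ℤ) :=
      ⟨_, hmemA p hp, rfl⟩
    rw [hd, ← AddSubgroup.zmultiples_eq_closure] at h1
    exact Int.mem_zmultiples_iff.1 h1
  obtain ⟨p0, hp0, hp0ne⟩ := hne
  have hd0 : d ≠ 0 := by
    rintro rfl
    have := zero_dvd_iff.1 (hdvd p0 hp0)
    exact hp0ne (sub_eq_zero.1 this)
  have habs : |d| ∈ A.map (AddMonoidHom.fst ℤ ℤ) := by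
    rw [hd, ← AddSubgroup.zmultiples_eq_closure, Int.mem_zmultiples_iff]
    exact (dvd_abs d d).2 dvd_rfl
  obtain ⟨⟨u', v⟩, ⟨⟨hA1, hA2⟩, hA3⟩, hu'⟩ := habs
  simp only [AddMonoidHom.coe_fst] at hu' hA1 hA2 hA3
  have hu'0 : 0 < u' := hu' ▸ abs_pos.2 hd0
  obtain ⟨u, hu⟩ := hA2
  have hg2 : (0 : ℤ) < (g : ℤ) ^ 2 := by positivity
  have hu0 : 0 < u := by
    rw [hu] at hu'0
    exact (mul_pos_iff_of_pos_left hg2).1 hu'0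
  lift u to ℕ using hu0.le
  have ht : ∀ p ∈ S, ∃ t : ℤ, gap p ^ 2 - gap w ^ 2 = t * ((g : ℤ) ^ 2 * u) ∧
        (tot p : ℤ) - tot w = t * v := by
    intro p hp
    obtain ⟨t, ht⟩ := (abs_dvd _ _).2 (hdvd p hp)
    rw [← hu'] at ht
    refine ⟨t, by rw [← hu, ht, mul_comm], ?_⟩
    have := hA3 p hp
    rw [ht] at this
    refine mul_left_cancel₀ hu'0.ne' ?_
    rw [this]; ring
  have hp0' : gap p0 ^ 2 - gap w ^ 2 ≠ 0 := sub_ne_zero.2 hp0ne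
  obtain ⟨t0, ht1, ht2⟩ := ht p0 hp0
  have ht0 : t0 ≠ 0 := by
    rintro rfl
    rw [zero_mul] at ht1; exact hp0' ht1
  have ht0' : 1 ≤ |t0| := Int.one_le_abs ht0
  refine ⟨u, v, by exact_mod_cast hu0, ?_, ?_, ?_, by rw [← hu]; exact hA1, ht⟩
  · have h1 := abs_gap_sq_sub_lt (hS hp0) (hS hw)
    rw [ht1, abs_mul, abs_of_pos (by positivity : (0 : ℤ) < (g : ℤ) ^ 2 * u)] at h1
    have h2 : (u : ℤ) ≤ (g : ℤ) ^ 2 * u := le_mul_of_one_le_left (by positivity) hg2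
    have h3 : (g : ℤ) ^ 2 * u ≤ |t0| * ((g : ℤ) ^ 2 * u) := le_mul_of_one_le_left (by positivity) ht0'
    have h4 : (u : ℤ) ≤ (H : ℤ) ^ 2 := by linarith
    exact_mod_cast h4
  -- If v = 0, then p0 and w would have equal `tot`, hence equal gap² because H² ≤ r, contrary to
  -- the choice of p0.
  · rintro rfl
    rw [mul_zero, sub_eq_zero] at ht2
    exact hp0' (gap_sq_eq_of_tot_eq hcop hH (hS hp0) (hS hw) (hSa p0 hp0) (hSa w hw)
      (by exact_mod_cast ht2))
  · have h1 := hSV p0 hp0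
    rw [ht2, abs_mul] at h1
    exact (le_mul_of_one_le_left (abs_nonneg v) ht0').trans h1

end Cell

/-! ### Logarithmic averages of arithmetic functions. -/

/-- The sum of the `e` with `e ^ 2 ∣ u`. -/
noncomputable def sqDivSum (u : ℕ) : ℝ := ∑ e ∈ u.divisors.filter (fun e => e * e ∣ u), (e : ℝ)

theorem sqDivSum_nonneg (u : ℕ) : 0 ≤ sqDivSum u := sum_nonneg fun _ _ => by positivity

theorem sum_one_div_filter_dvd_le (N : ℕ) {q : ℕ} (hq : 0 < q) :
    ∑ n ∈ (Icc 1 N).filter (fun n => q ∣ n), (1 : ℝ) / n ≤ (1 / q) * ∑ w ∈ Icc 1 N, (1 : ℝ) / w := by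
  rw [mul_sum]
  have hq1 : (q : ℝ) ≠ 0 := by positivity
  calc _ = ∑ n ∈ (Icc 1 N).filter (fun n => q ∣ n), (1 / q) * ((1 : ℝ) / (n / q : ℕ)) := by
        refine sum_congr rfl fun n hn => ?_
        obtain ⟨k, rfl⟩ := (mem_filter.1 hn).2
        rw [Nat.mul_div_cancel_left _ hq]
        push_cast
        rw [one_div_mul_one_div]
    _ = ∑ w ∈ ((Icc 1 N).filter (fun n => q ∣ n)).image (fun n => n / q),
          (1 / q) * ((1 : ℝ) / w) := by
        rw [sum_image]
        intro x hx y hy h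
        have h1 := (mem_filter.1 hx).2
        have h2 := (mem_filter.1 hy).2
        rw [← Nat.div_mul_cancel h1, ← Nat.div_mul_cancel h2]
        exact congrArg (· * q) h
    _ ≤ _ := by
        refine sum_le_sum_of_subset_of_nonneg ?_ fun _ _ _ => by positivity
        intro w hw
        obtain ⟨n, hn, rfl⟩ := mem_image.1 hw
        obtain ⟨h1, k, rfl⟩ := mem_filter.1 hn
        rw [mem_Icc] at h1 ⊢
        rw [Nat.mul_div_cancel_left _ hq]
        refine ⟨Nat.pos_of_mul_pos_left (Nat.lt_of_lt_of_le Nat.zero_lt_one h1.1), ?_⟩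
        exact (Nat.le_mul_of_pos_left k hq).trans h1.2

/-- The gcd is bounded by the sum of all q ∣ r with q ∣ 2n. For each q, the sum over m = 2n ≤ 2V ≤
4r of 2q/m is at most 2T. -/
theorem sum_gcd_div_le {r V : ℕ} (hr : 0 < r) {T : ℝ} (hVr : V ≤ 2 * r)
    (hT : ∀ n : ℕ, 0 < n → n ≤ r → (n.divisors.card : ℝ) ≤ T)
    (hL : ∀ N : ℕ, N ≤ 4 * r → ∑ w ∈ Icc 1 N, (1 : ℝ) / w ≤ T) :
    ∑ n ∈ Icc 1 V, (Nat.gcd (2 * n) r : ℝ) / n ≤ 2 * T ^ 2 := by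
  have hT0 : 0 ≤ T := le_trans (by positivity) (hT r hr le_rfl)
  calc _ ≤ ∑ n ∈ Icc 1 V, ∑ q ∈ r.divisors, (if q ∣ 2 * n then (q : ℝ) / n else 0) := by
        refine sum_le_sum fun n _ => ?_
        rw [← sum_filter]
        exact single_le_sum (f := fun q : ℕ => (q : ℝ) / n) (fun _ _ => by positivity)
          (mem_filter.2 ⟨Nat.mem_divisors.2 ⟨Nat.gcd_dvd_right _ _, hr.ne'⟩, Nat.gcd_dvd_left _ _⟩)
    _ = ∑ q ∈ r.divisors, ∑ n ∈ (Icc 1 V).filter (fun n => q ∣ 2 * n), (q : ℝ) / n := by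
        rw [sum_comm]; simp only [sum_filter]
    _ ≤ ∑ q ∈ r.divisors, 2 * T := by
        refine sum_le_sum fun q hq => ?_
        have hq0 : 0 < q := Nat.pos_of_mem_divisors hq
        calc _ = ∑ n ∈ (Icc 1 V).filter (fun n => q ∣ 2 * n), (2 * q : ℝ) * (1 / ((2 * n : ℕ) : ℝ)) := by
              refine sum_congr rfl fun n hn => ?_
              push_cast
              rw [mul_one_div, mul_div_mul_left _ _ two_ne_zero]
          _ = ∑ m ∈ (((Icc 1 V).filter (fun n => q ∣ 2 * n)).image (fun n => 2 * n) : Finset ℕ),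
                (2 * q : ℝ) * (1 / (m : ℝ)) := by
              rw [sum_image]
              intro x _ y _ h
              simpa using h
          _ ≤ ∑ m ∈ (Icc 1 (2 * V)).filter (fun m => q ∣ m), (2 * q : ℝ) * (1 / (m : ℝ)) := by
              refine sum_le_sum_of_subset_of_nonneg ?_ fun _ _ _ => by positivity
              intro m hm
              obtain ⟨n, hn, rfl⟩ := mem_image.1 hm
              simp only [mem_filter, mem_Icc] at hn ⊢
              exact ⟨⟨by omega, by omega⟩, hn.2⟩
          _ ≤ 2 * q * ((1 / q) * T) := by
              rw [← mul_sum]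
              gcongr
              refine (sum_one_div_filter_dvd_le _ hq0).trans ?_
              gcongr
              exact hL _ (by omega)
          _ = 2 * T := by field_simp
    _ = r.divisors.card * (2 * T) := by rw [sum_const, nsmul_eq_mul]
    _ ≤ T * (2 * T) := by gcongr; exact hT r hr le_rfl
    _ = _ := by ring

theorem sum_sqDivSum_div_le {r N : ℕ} (hN : N ≤ r) {T : ℝ} (hT0 : 0 ≤ T)
    (hL : ∀ N : ℕ, N ≤ 4 * r → ∑ w ∈ Icc 1 N, (1 : ℝ) / w ≤ T) :
    ∑ u ∈ Icc 1 N, sqDivSum u / u ≤ T ^ 2 := by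
  calc _ ≤ ∑ u ∈ Icc 1 N, ∑ e ∈ Icc 1 N, (if e * e ∣ u then (e : ℝ) / u else 0) := by
        refine sum_le_sum fun u hu => ?_
        rw [sqDivSum, sum_div, ← sum_filter]
        refine sum_le_sum_of_subset_of_nonneg ?_ fun _ _ _ => by positivity
        intro e he
        obtain ⟨h1, h2⟩ := mem_filter.1 he
        rw [mem_Icc] at hu
        refine mem_filter.2 ⟨mem_Icc.2 ⟨Nat.pos_of_mem_divisors h1, ?_⟩, h2⟩
        exact (Nat.divisor_le h1).trans hu.2
    _ = ∑ e ∈ Icc 1 N, ∑ u ∈ (Icc 1 N).filter (fun u => e * e ∣ u), (e : ℝ) * (1 / u) := by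
        rw [sum_comm]; simp only [sum_filter, mul_one_div]
    _ ≤ ∑ e ∈ Icc 1 N, (1 : ℝ) / e * T := by
        refine sum_le_sum fun e he => ?_
        have he0 : 0 < e := (mem_Icc.1 he).1
        rw [← mul_sum]
        calc _ ≤ (e : ℝ) * ((1 / (e * e : ℕ)) * T) := by
              gcongr
              refine (sum_one_div_filter_dvd_le _ (Nat.mul_pos he0 he0)).trans ?_
              gcongr
              exact hL _ (by omega)
          _ = _ := by push_cast; field_simp
    _ ≤ T * T := by
        rw [← sum_mul]
        gcongr
        exact hL _ (by omega)
    _ = _ := by ring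

/-- The parameter t satisfies |t||v| ≤ V, so there are at most 2K + 1 values of gap² with K = V /
|v|, and twice as many gaps; K ≥ 1 turns 2(2K + 1) into 6K. -/
theorem card_gap_le_of_line {r V : ℕ} {w : (ℕ × ZMod r) × (ℕ × ZMod r)}
    {S : Finset ((ℕ × ZMod r) × (ℕ × ZMod r))} {b v : ℤ} (hv : v ≠ 0)
    (hvV : |v| ≤ V) (hSV : ∀ p ∈ S, |(tot p : ℤ) - tot w| ≤ V)
    (ht : ∀ p ∈ S, ∃ t : ℤ, gap p ^ 2 - gap w ^ 2 = t * b ∧ (tot p : ℤ) - tot w = t * v) :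
    ((S.image gap).card : ℝ) ≤ 6 * V / v.natAbs := by
  set n := v.natAbs with hn
  have hn0 : 0 < n := Int.natAbs_pos.2 hv
  have hnV : n ≤ V := by
    rw [Int.abs_eq_natAbs] at hvV
    exact_mod_cast hvV
  set K := V / n with hK
  have hK1 : 1 ≤ K := Nat.div_pos hnV hn0
  have h1 : (S.image gap).card ≤ 2 * ((S.image gap).image fun h => h ^ 2).card := by
    refine card_le_mul_card_image _ _ fun c hc => ?_
    obtain ⟨h0, -, rfl⟩ := mem_image.1 hc
    calc _ ≤ ({h0, -h0} : Finset ℤ).card := by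
          refine card_le_card fun h hh => ?_
          have := (mem_filter.1 hh).2
          rcases sq_eq_sq_iff_eq_or_eq_neg.1 this with e | e <;> simp [e]
      _ ≤ 2 := card_le_two
  have h2 : ((S.image gap).image fun h => h ^ 2).card ≤ 2 * K + 1 := by
    calc _ ≤ ((Icc (-(K : ℤ)) K).image fun t => gap w ^ 2 + t * b).card := by
          refine card_le_card fun c hc => ?_
          obtain ⟨h, hh, rfl⟩ := mem_image.1 hc
          obtain ⟨p, hp, rfl⟩ := mem_image.1 hh
          obtain ⟨t, ht1, ht2⟩ := ht p hp
          refine mem_image.2 ⟨t, ?_, by linarith⟩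
          have h3 := hSV p hp
          rw [ht2, abs_mul, Int.abs_eq_natAbs v, ← hn] at h3
          rw [mem_Icc, ← abs_le, hK, Int.natCast_div,
            Int.le_ediv_iff_mul_le (by exact_mod_cast hn0)]
          exact h3
      _ ≤ (Icc (-(K : ℤ)) K).card := card_image_le
      _ = _ := by rw [Int.card_Icc]; omega
  have h3 : (S.image gap).card ≤ 6 * K := by omega
  calc ((S.image gap).card : ℝ) ≤ ((6 * K : ℕ) : ℝ) := by exact_mod_cast h3
    _ = 6 * (K : ℝ) := by push_cast; ring
    _ ≤ 6 * ((V : ℝ) / n) := by gcongr; rw [hK]; exact Nat.cast_div_le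
    _ = _ := by ring

/-! ### Counting gaps and the energy of a cell. -/

section Cell

variable {r j M H V : ℕ} [NeZero r] {a : ZMod r} {w : (ℕ × ZMod r) × (ℕ × ZMod r)}

/-- After division by g the gaps lie in an interval of length 2(H/g) and have the same square modulo
u. `sqDivSum u` dominates each possible loss `splitGcd`. -/
theorem card_gap_le_of_modulus {T : ℝ} (hcop : Nat.Coprime r j)
    (hT : ∀ n : ℕ, 0 < n → n ≤ r → (n.divisors.card : ℝ) ≤ T)
    {S : Finset ((ℕ × ZMod r) × (ℕ × ZMod r))} (hS : S ⊆ closePairs r j M H)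
    (hSa : ∀ p ∈ S, pairDiff p = a) (hw : w ∈ S) {u : ℕ} (hu : 0 < u) (hur : u ≤ r)
    (ht : ∀ p ∈ S, ∃ t : ℤ, gap p ^ 2 - gap w ^ 2 = t * ((Nat.gcd a.val r : ℕ) ^ 2 * u)) :
    ((S.image gap).card : ℝ) ≤
      T * (2 * (H / (Nat.gcd a.val r : ℕ)) * sqDivSum u / u + 1) := by
  have hr : 0 < r := Nat.pos_of_ne_zero (NeZero.ne r)
  set g := Nat.gcd a.val r with hg
  have hg0 : 0 < g := Nat.gcd_pos_of_pos_right _ hr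
  have hg0' : (0 : ℤ) < g := by exact_mod_cast hg0
  have hdiv : ∀ p ∈ S, (g : ℤ) ∣ gap p := fun p hp => gcd_dvd_closePairs hcop (hS hp) (hSa p hp)
  have hB0 := sqDivSum_nonneg u
  have h1 := card_sq_congr_le (S := (S.image gap).image fun h => h / g) (N := u)
    (z := gap w / g) (A := -((H / g : ℕ) : ℤ)) (L := 2 * (H / g)) (B := sqDivSum u) hu hB0
    (by
      intro x hx
      obtain ⟨h, hh, rfl⟩ := mem_image.1 hx
      obtain ⟨p, hp, rfl⟩ := mem_image.1 hh
      obtain ⟨k, hk⟩ := hdiv p hp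
      have hle := abs_gap_le (hS hp)
      rw [hk, abs_mul, abs_of_pos hg0'] at hle
      rw [hk, Int.mul_ediv_cancel_left _ hg0'.ne']
      have : |k| ≤ ((H / g : ℕ) : ℤ) := by
        rw [Int.natCast_div, Int.le_ediv_iff_mul_le hg0']; linarith
      rw [abs_le] at this
      push_cast at this ⊢
      constructor <;> linarith)
    (by
      intro x hx
      obtain ⟨h, hh, rfl⟩ := mem_image.1 hx
      obtain ⟨p, hp, rfl⟩ := mem_image.1 hh
      obtain ⟨k, hk⟩ := hdiv p hp
      obtain ⟨l, hl⟩ := hdiv w hw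
      obtain ⟨t, ht⟩ := ht p hp
      rw [hk, hl] at ht
      rw [hk, hl, Int.mul_ediv_cancel_left _ hg0'.ne', Int.mul_ediv_cancel_left _ hg0'.ne']
      refine ⟨t, mul_left_cancel₀ (pow_pos hg0' 2).ne' ?_⟩
      linear_combination ht)
    (by
      intro x _
      have := splitGcd_mul_self_dvd u (x - gap w / g)
      rw [sqDivSum]
      exact single_le_sum (f := fun e : ℕ => (e : ℝ)) (fun _ _ => by positivity)
        (mem_filter.2 ⟨Nat.mem_divisors.2 ⟨splitGcd_dvd_self _ _, hu.ne'⟩, this⟩))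
  rw [card_image_of_injOn] at h1
  · have hT1 := hT u hu hur
    have hT0 : 0 ≤ T := le_trans (by positivity) hT1
    refine h1.trans ?_
    push_cast
    gcongr
    exact Nat.cast_div_le
  · intro x hx y hy h
    simp only [coe_image, Set.mem_image, mem_coe] at hx hy
    obtain ⟨p, hp, rfl⟩ := hx
    obtain ⟨q, hq, rfl⟩ := hy
    rw [← Int.ediv_mul_cancel (hdiv p hp), ← Int.ediv_mul_cancel (hdiv q hq)]
    exact congrArg (· * (g : ℤ)) h

/-- Either a cell has few gaps, or their number is controlled by the slope of its line. -/
theorem card_gap_cell {T : ℝ} (hcop : Nat.Coprime r j) (hH : H ^ 2 ≤ r) (hV : 2 * H ^ 2 * V ≤ r)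
    (hT : ∀ n : ℕ, 0 < n → n ≤ r → (n.divisors.card : ℝ) ≤ T)
    {S : Finset ((ℕ × ZMod r) × (ℕ × ZMod r))} (hS : S ⊆ closePairs r j M H)
    (hSa : ∀ p ∈ S, pairDiff p = a) (hSV : ∀ p ∈ S, ∀ q ∈ S, |(tot p : ℤ) - tot q| ≤ V)
    (hbig : 2 * T < (S.image gap).card) :
    ∃ u n : ℕ, u ∈ Icc 1 (H ^ 2) ∧ n ∈ Icc 1 V ∧
      ((r : ℤ) ∣ j * ((Nat.gcd a.val r : ℕ) ^ 2 * u) - 2 * (a.val : ℤ) ^ 2 * n ∨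
        (r : ℤ) ∣ j * ((Nat.gcd a.val r : ℕ) ^ 2 * u) - 2 * (a.val : ℤ) ^ 2 * (-n)) ∧
      ((S.image gap).card : ℝ) ^ 2 ≤
        24 * T * V * H / (Nat.gcd a.val r : ℕ) * ((sqDivSum u / u) * (1 / n)) := by
  have hr : 0 < r := Nat.pos_of_ne_zero (NeZero.ne r)
  have hT1 : 1 ≤ T := by simpa using hT 1 one_pos hr
  have hne : S.Nonempty := by
    rw [nonempty_iff_ne_empty]
    rintro rfl
    simp at hbig; linarith
  obtain ⟨w, hw⟩ := hne
  have hex : ∃ p ∈ S, gap p ^ 2 ≠ gap w ^ 2 := by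
    by_contra! hcon
    have : (S.image gap).card ≤ 2 := by
      calc _ ≤ ({gap w, -gap w} : Finset ℤ).card := by
            refine card_le_card fun h hh => ?_
            obtain ⟨p, hp, rfl⟩ := mem_image.1 hh
            rcases sq_eq_sq_iff_eq_or_eq_neg.1 (hcon p hp) with e | e <;> simp [e]
        _ ≤ 2 := card_le_two
    have : ((S.image gap).card : ℝ) ≤ 2 := by exact_mod_cast this
    linarith
  obtain ⟨u, v, hu0, huH, hv0, hvV, hdvd, hline⟩ := exists_cell_line hcop hH hV hS hSa hw
    (fun p hp => hSV p hp w hw) hex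
  have b1 := card_gap_le_of_line hv0 hvV (fun p hp => hSV p hp w hw) hline
  have b2 := card_gap_le_of_modulus hcop hT hS hSa hw hu0 (huH.trans hH)
    (fun p hp => (hline p hp).imp fun _ h => h.1)
  have hn0 : 0 < v.natAbs := Int.natAbs_pos.2 hv0
  refine ⟨u, v.natAbs, mem_Icc.2 ⟨hu0, huH⟩, mem_Icc.2 ⟨hn0, ?_⟩, ?_, ?_⟩
  · rw [Int.abs_eq_natAbs] at hvV
    exact_mod_cast hvV
  · rcases Int.natAbs_eq v with e | e
    · left; rw [← e]; exact hdvd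
    · right; rw [← e]; exact hdvd
  · set g := Nat.gcd a.val r with hg
    have hg0 : 0 < g := Nat.gcd_pos_of_pos_right _ hr
    set P : ℝ := ((S.image gap).card : ℝ) with hP
    have b3 : P ≤ T * (4 * (H / g) * sqDivSum u / u) := by
      -- Having more than 2T gaps means that the +1 in `b2` is not the dominant term, so it costs
      -- only a factor 2.
      have hx : 1 ≤ 2 * ((H : ℝ) / g) * sqDivSum u / u := by
        by_contra! hlt
        have : P ≤ T * 2 := b2.trans (by gcongr; linarith)
        linarith
      refine b2.trans ?_
      gcongr
      have : 4 * ((H : ℝ) / g) * sqDivSum u / u = 2 * (2 * ((H : ℝ) / g) * sqDivSum u / u) := by ring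
      linarith
    have hP0 : 0 ≤ P := by positivity
    calc P ^ 2 = P * P := sq P
      _ ≤ (6 * V / v.natAbs) * (T * (4 * (H / g) * sqDivSum u / u)) :=
          mul_le_mul b1 b3 hP0 (by positivity)
      _ = _ := by ring

/-- Two solutions a, z satisfy a² ≡ z² modulo r/gcd(2v, r). The loss `splitGcd` divides 2z and r,
hence 2g. -/
theorem card_line_fiber_le {T : ℝ}
    (hT : ∀ n : ℕ, 0 < n → n ≤ r → (n.divisors.card : ℝ) ≤ T) (g : ℕ) (c : ℤ) {v : ℤ} :
    ((univ.filter fun a : ZMod r => Nat.gcd a.val r = g ∧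
      (r : ℤ) ∣ c - 2 * (a.val : ℤ) ^ 2 * v).card : ℝ) ≤ 3 * T * g * Nat.gcd (2 * v.natAbs) r := by
  have hr : 0 < r := Nat.pos_of_ne_zero (NeZero.ne r)
  have hT0 : 0 ≤ T := le_trans (by positivity) (hT r hr le_rfl)
  set S := univ.filter fun a : ZMod r => Nat.gcd a.val r = g ∧
      (r : ℤ) ∣ c - 2 * (a.val : ℤ) ^ 2 * v with hS
  rcases S.eq_empty_or_nonempty with he | ⟨z, hz⟩
  · rw [he]; simp; positivity
  have hz' := (mem_filter.1 hz).2
  have hg0 : 0 < g := hz'.1 ▸ Nat.gcd_pos_of_pos_right _ hr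
  have hG : Int.gcd (2 * v) r = Nat.gcd (2 * v.natAbs) r := by
    rw [Int.gcd_eq_natAbs, Int.natAbs_mul]; rfl
  set G := Nat.gcd (2 * v.natAbs) r with hGdef
  have hG0 : 0 < G := Nat.gcd_pos_of_pos_right _ hr
  have hGr : G ∣ r := Nat.gcd_dvd_right _ _
  have hN0 : 0 < r / G := Nat.div_pos (Nat.le_of_dvd hr hGr) hG0
  have hNr : r / G ∣ r := Nat.div_dvd_of_dvd hGr
  have hd : ∀ x ∈ S, ((r / G : ℕ) : ℤ) ∣ (x.val : ℤ) ^ 2 - (z.val : ℤ) ^ 2 := by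
    intro x hx
    have h1 := (mem_filter.1 hx).2.2
    have h2 := div_gcd_dvd_of_dvd_mul hr (y := 2 * v)
      (w := (x.val : ℤ) ^ 2 - (z.val : ℤ) ^ 2)
      ((dvd_sub hz'.2 h1).trans (dvd_of_eq (by ring)))
    rwa [hG] at h2
  have h := card_sq_eq_le (S := S) (z := z.val) (B := 2 * g) hN0 (Nat.div_le_self _ _) hT
    (by positivity) hd (by
      intro x hx
      set e := splitGcd (r / G) ((x.val : ℤ) - z.val) with he
      have he1 : e ∣ r := (splitGcd_dvd_self _ _).trans hNr
      have he2 : (e : ℤ) ∣ (x.val : ℤ) - z.val := splitGcd_dvd_left _ _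
      have he3 : (e : ℤ) ∣ (x.val : ℤ) + z.val := splitGcd_dvd_of_dvd_mul hN0
        ((hd x hx).trans (dvd_of_eq (by ring)))
      have he4 : (e : ℤ) ∣ 2 * z.val := (dvd_sub he3 he2).trans (dvd_of_eq (by ring))
      have he5 : e ∣ 2 * z.val := by exact_mod_cast he4
      have he6 : e ∣ 2 * g := by
        rw [← hz'.1, ← Nat.gcd_mul_left]
        exact Nat.dvd_gcd he5 (he1.mul_left _)
      have := Nat.le_of_dvd (by omega) he6
      exact_mod_cast this)
  have hrG : (r : ℝ) = ((r / G : ℕ) : ℝ) * G := by exact_mod_cast (Nat.div_mul_cancel hGr).symm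
  have hN0' : ((r / G : ℕ) : ℝ) ≠ 0 := by positivity
  have e1 : (r : ℝ) * (2 * g) / ((r / G : ℕ) : ℝ) = 2 * g * G := by
    rw [div_eq_iff hN0']
    nth_rewrite 1 [hrG]; ring
  rw [e1] at h
  have h1 : (1 : ℝ) ≤ g * G := by exact_mod_cast Nat.mul_pos hg0 hG0
  calc _ ≤ T * (2 * g * G + 1) := h
    _ ≤ T * (2 * g * G + g * G) := by gcongr
    _ = _ := by ring

/-- The energy of the pairs with almost constant sum of first coordinates. -/
theorem fiberEnergy_cell_le {T : ℝ} (hcop : Nat.Coprime r j) (hM : M ≤ r) (hH : H ^ 2 ≤ r)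
    (hV : 2 * H ^ 2 * V ≤ r) (hVr : V ≤ 2 * r)
    (hT : ∀ n : ℕ, 0 < n → n ≤ r → (n.divisors.card : ℝ) ≤ T)
    (hL : ∀ N : ℕ, N ≤ 4 * r → ∑ w ∈ Icc 1 N, (1 : ℝ) / w ≤ T)
    {S : Finset ((ℕ × ZMod r) × (ℕ × ZMod r))} (hS : S ⊆ primPairs r j M H)
    (hSV : ∀ p ∈ S, ∀ q ∈ S, |(tot p : ℤ) - tot q| ≤ V) :
    (fiberEnergy S pairDiff : ℝ) ≤ 6 * T ^ 2 * S.card + 2592 * T ^ 9 * V * H := by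
  classical
  have hr : 0 < r := Nat.pos_of_ne_zero (NeZero.ne r)
  have hT1 : 1 ≤ T := by simpa using hT 1 one_pos hr
  set C : ZMod r → Finset ((ℕ × ZMod r) × (ℕ × ZMod r)) :=
    fun a => S.filter fun p => pairDiff p = a with hC
  set P : ZMod r → ℝ := fun a => (((C a).image gap).card : ℝ) with hP
  have hCS : ∀ a, C a ⊆ S := fun a => filter_subset _ _
  have hCa : ∀ a, ∀ p ∈ C a, pairDiff p = a := fun a p hp => (mem_filter.1 hp).2
  have hCV : ∀ a, ∀ p ∈ C a, ∀ q ∈ C a, |(tot p : ℤ) - tot q| ≤ V :=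
    fun a p hp q hq => hSV p (hCS a hp) q (hCS a hq)
  have hcell : ∀ a, ((C a).card : ℝ) ≤ 3 * T * P a := fun a =>
    card_cell_le hcop hM hV hT ((hCS a).trans hS) (hCa a) (hCV a)
  set big := univ.filter fun a : ZMod r => 2 * T < P a with hbig
  -- If P a ≤ 2T then the fibre has at most 6T² pairs and its square is linear in its size; only the
  -- other values of a need the line.
  have hpt : ∀ a, ((C a).card : ℝ) ^ 2 ≤
      6 * T ^ 2 * (C a).card + 9 * T ^ 2 * (if 2 * T < P a then P a ^ 2 else 0) := by
    intro a
    have h0 : (0 : ℝ) ≤ (C a).card := by positivity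
    split_ifs with h
    · calc ((C a).card : ℝ) ^ 2 ≤ (3 * T * P a) ^ 2 := by gcongr; exact hcell a
        _ = 9 * T ^ 2 * P a ^ 2 := by ring
        _ ≤ _ := by
          have : 0 ≤ 6 * T ^ 2 * ((C a).card : ℝ) := by positivity
          linarith
    · have h1 : ((C a).card : ℝ) ≤ 6 * T ^ 2 := by
        calc _ ≤ 3 * T * P a := hcell a
          _ ≤ 3 * T * (2 * T) := by gcongr; exact not_lt.1 h
          _ = _ := by ring
      rw [mul_zero, add_zero, sq]
      gcongr
  have hcard : ∑ a : ZMod r, ((C a).card : ℝ) = S.card := by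
    rw [card_eq_sum_card_fiberwise (f := pairDiff) (t := univ) (fun _ _ => by simp)]
    push_cast; rfl
  have hchoose : ∀ a : ZMod r, ∃ un : ℕ × ℕ, a ∈ big → un ∈ Icc 1 (H ^ 2) ×ˢ Icc 1 V ∧
      ((r : ℤ) ∣ j * ((Nat.gcd a.val r : ℕ) ^ 2 * un.1) - 2 * (a.val : ℤ) ^ 2 * un.2 ∨
        (r : ℤ) ∣ j * ((Nat.gcd a.val r : ℕ) ^ 2 * un.1) - 2 * (a.val : ℤ) ^ 2 * (-un.2)) ∧
      P a ^ 2 ≤ 24 * T * V * H / (Nat.gcd a.val r : ℕ) * ((sqDivSum un.1 / un.1) * (1 / un.2)) := by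
    intro a
    by_cases ha : a ∈ big
    · obtain ⟨u, n, h1, h2, h3, h4⟩ := card_gap_cell hcop hH hV hT
        (((hCS a).trans hS).trans (filter_subset _ _)) (hCa a) (hCV a) (mem_filter.1 ha).2
      exact ⟨(u, n), fun _ => ⟨mem_product.2 ⟨h1, h2⟩, h3, h4⟩⟩
    · exact ⟨(0, 0), fun h => absurd h ha⟩
  choose φ hφ using hchoose
  have hg : ∀ g ∈ r.divisors, ∑ a ∈ big.filter (fun a => Nat.gcd a.val r = g), P a ^ 2 ≤
      288 * T ^ 6 * V * H := by
    intro g hgr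
    have hg0 : 0 < g := Nat.pos_of_mem_divisors hgr
    set X := big.filter (fun a => Nat.gcd a.val r = g) with hX
    set κ : ℝ := 24 * T * V * H / g with hκ
    set W : ℕ × ℕ → ℝ := fun un => (sqDivSum un.1 / un.1) * (1 / un.2) with hW
    have hW0 : ∀ un, 0 ≤ W un := fun un => by
      have := sqDivSum_nonneg un.1
      simp only [hW]; positivity
    -- The direction is recorded only up to the sign of v, so two line fibres contribute. The factor
    -- g in this count cancels the 1/g in κ.
    have hfib : ∀ un : ℕ × ℕ, ((X.filter fun a => φ a = un).card : ℝ) ≤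
        6 * T * g * Nat.gcd (2 * un.2) r := by
      rintro ⟨u, n⟩
      set F : ℤ → Finset (ZMod r) := fun v => univ.filter fun a : ZMod r => Nat.gcd a.val r = g ∧
        (r : ℤ) ∣ j * ((g : ℤ) ^ 2 * u) - 2 * (a.val : ℤ) ^ 2 * v with hF
      have hsub : (X.filter fun a => φ a = (u, n)) ⊆ F n ∪ F (-n) := by
        intro a ha
        obtain ⟨haX, haφ⟩ := mem_filter.1 ha
        obtain ⟨hab, hag⟩ := mem_filter.1 haX
        have h2 := (hφ a hab).2.1
        rw [haφ, hag] at h2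
        rw [mem_union]
        exact h2.imp (fun h => mem_filter.2 ⟨mem_univ _, hag, h⟩)
          (fun h => mem_filter.2 ⟨mem_univ _, hag, h⟩)
      have h1 := card_line_fiber_le (r := r) hT g (j * ((g : ℤ) ^ 2 * u)) (v := n)
      have h2 := card_line_fiber_le (r := r) hT g (j * ((g : ℤ) ^ 2 * u)) (v := -n)
      rw [Int.natAbs_neg, Int.natAbs_natCast] at h2
      rw [Int.natAbs_natCast] at h1
      have h3 := (card_le_card hsub).trans (card_union_le _ _)
      have h4 : ((X.filter fun a => φ a = (u, n)).card : ℝ) ≤ (F n).card + (F (-n)).card := by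
        exact_mod_cast h3
      simp only [hF] at h4
      linarith
    calc ∑ a ∈ X, P a ^ 2 ≤ ∑ a ∈ X, κ * W (φ a) := by
          refine sum_le_sum fun a ha => ?_
          obtain ⟨hab, hag⟩ := mem_filter.1 ha
          have := (hφ a hab).2.2
          rw [hag] at this
          exact this
      _ = ∑ un ∈ Icc 1 (H ^ 2) ×ˢ Icc 1 V, ∑ a ∈ X.filter (fun a => φ a = un), κ * W (φ a) :=
          (sum_fiberwise_of_maps_to (fun a ha => (hφ a (mem_filter.1 ha).1).1) _).symm
      _ = ∑ un ∈ Icc 1 (H ^ 2) ×ˢ Icc 1 V, ((X.filter fun a => φ a = un).card : ℝ) * (κ * W un) := by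
          refine sum_congr rfl fun un _ => ?_
          rw [sum_congr rfl (g := fun _ => κ * W un)
            (fun a ha => by rw [(mem_filter.1 ha).2]), sum_const, nsmul_eq_mul]
      _ ≤ ∑ un ∈ Icc 1 (H ^ 2) ×ˢ Icc 1 V,
            (6 * T * g * Nat.gcd (2 * un.2) r) * (κ * W un) := by
          refine sum_le_sum fun un _ => ?_
          have hκ0 : 0 ≤ κ := by positivity
          exact mul_le_mul_of_nonneg_right (hfib un) (mul_nonneg hκ0 (hW0 un))
      _ = 6 * T * g * κ * ((∑ u ∈ Icc 1 (H ^ 2), sqDivSum u / u) *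
            ∑ n ∈ Icc 1 V, (Nat.gcd (2 * n) r : ℝ) / n) := by
          rw [sum_mul_sum, ← sum_product', mul_sum]
          refine sum_congr rfl fun un _ => ?_
          simp only [hW]
          ring
      _ ≤ 6 * T * g * κ * (T ^ 2 * (2 * T ^ 2)) := by
          gcongr
          · exact sum_sqDivSum_div_le hH (by linarith) hL
          · exact sum_gcd_div_le hr hVr hT hL
      _ = _ := by
          rw [hκ]
          field_simp
          ring
  have hsumbig : ∑ a ∈ big, P a ^ 2 ≤ 288 * T ^ 7 * V * H := by
    rw [← sum_fiberwise_of_maps_to (s := big) (t := r.divisors) (g := fun a => Nat.gcd a.val r)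
      (fun a _ => Nat.mem_divisors.2 ⟨Nat.gcd_dvd_right _ _, hr.ne'⟩)]
    refine (sum_le_card_nsmul _ _ _ hg).trans ?_
    rw [nsmul_eq_mul]
    calc _ ≤ T * (288 * T ^ 6 * V * H) := by gcongr; exact hT r hr le_rfl
      _ = _ := by ring
  calc (fiberEnergy S pairDiff : ℝ) = ∑ a : ZMod r, ((C a).card : ℝ) ^ 2 := by
        rw [fiberEnergy]; push_cast; rfl
    _ ≤ ∑ a : ZMod r, (6 * T ^ 2 * (C a).card + 9 * T ^ 2 * (if 2 * T < P a then P a ^ 2 else 0)) :=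
        sum_le_sum fun a _ => hpt a
    _ = 6 * T ^ 2 * S.card + 9 * T ^ 2 * ∑ a ∈ big, P a ^ 2 := by
        rw [sum_add_distrib, ← mul_sum, ← mul_sum, hcard, hbig, sum_filter]
    _ ≤ 6 * T ^ 2 * S.card + 9 * T ^ 2 * (288 * T ^ 7 * V * H) := by gcongr
    _ = _ := by ring

end Cell

/-! ### Assembling the energy bound. -/

section Energy

variable {r j M H : ℕ} [NeZero r] {T : ℝ}

/-- Sufficient when HM ≥ r, since then H²M ≤ H³M²/r. -/
theorem fiberEnergy_closePairs_le_trivial (hcop : Nat.Coprime r j) (hM : M ≤ r)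
    (hT : ∀ n : ℕ, 0 < n → n ≤ r → (n.divisors.card : ℝ) ≤ T) :
    (fiberEnergy (closePairs r j M H) pairDiff : ℝ) ≤ 128 * T ^ 3 * H ^ 2 * M := by
  have h1 : (fiberEnergy (closePairs r j M H) pairDiff : ℝ) ≤
      (4 * H : ℕ) * ((closePairs r j M H).card : ℝ) := by
    exact_mod_cast fiberEnergy_le_mul_card fun a => card_closePairs_diff_le hcop hM a
  calc _ ≤ _ := h1
    _ ≤ (4 * H : ℕ) * (32 * T ^ 3 * H * M) := by gcongr; exact card_closePairs_le hcop hT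
    _ = _ := by push_cast; ring

theorem fiberEnergy_mono {α G : Type*} [Fintype G] [DecidableEq G] {S S' : Finset α} (h : S ⊆ S')
    (δ : α → G) : fiberEnergy S δ ≤ fiberEnergy S' δ :=
  sum_le_sum fun _ _ => Nat.pow_le_pow_left (card_le_card (filter_subset_filter _ h)) 2

theorem fiberEnergy_primPairs_le_of_lt (hcop : Nat.Coprime r j) (hH0 : 0 < H) (hHM : H ≤ M)
    (hM : M ≤ r) (hlt : H * M < r)
    (hT : ∀ n : ℕ, 0 < n → n ≤ r → (n.divisors.card : ℝ) ≤ T)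
    (hL : ∀ N : ℕ, N ≤ 4 * r → ∑ w ∈ Icc 1 N, (1 : ℝ) / w ≤ T) :
    (fiberEnergy (primPairs r j M H) pairDiff : ℝ) ≤
      10560 * T ^ 9 * (H * M) * (4 * H ^ 2 * M / r + 1) := by
  have hr : 0 < r := Nat.pos_of_ne_zero (NeZero.ne r)
  have hT1 : 1 ≤ T := by simpa using hT 1 one_pos hr
  have hH : H ^ 2 ≤ r := by nlinarith
  -- Blocks of D + 1 consecutive values of `tot` have diameter at most D, the largest V with 2H²V ≤
  -- r. Capping V at 2M keeps nV ≤ 4M even when a single block suffices.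
  set D := r / (2 * H ^ 2) with hD
  set V := min D (2 * M) with hV
  set n := 2 * M / (D + 1) + 1 with hn
  have hcM : ∀ p ∈ primPairs r j M H, tot p ≤ 2 * M := by
    intro p hp
    obtain ⟨⟨h1, h2⟩, -⟩ := mem_closePairs.1 (mem_filter.1 hp).1
    have h1 := (mem_rootPts.1 h1).1.2
    have h2 := (mem_rootPts.1 h2).1.2
    rw [tot]; omega
  have hnV : n * V ≤ 4 * M := by
    have h1 : 2 * M / (D + 1) * V ≤ 2 * M := by
      calc _ ≤ 2 * M / (D + 1) * (D + 1) := by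
            gcongr; exact (min_le_left _ _).trans (Nat.le_succ _)
        _ ≤ _ := Nat.div_mul_le_self _ _
    have h2 : V ≤ 2 * M := min_le_right _ _
    rw [hn, add_mul]; omega
  have hn' : (n : ℝ) ≤ 4 * H ^ 2 * M / r + 1 := by
    rw [hn]; push_cast
    gcongr
    have h1 : (r : ℝ) / (2 * H ^ 2) ≤ (D : ℝ) + 1 := by
      have := Nat.lt_div_mul_add (a := r) (b := 2 * H ^ 2) (by positivity)
      rw [div_le_iff₀ (by positivity)]
      have h2 : r ≤ (D + 1) * (2 * H ^ 2) := by rw [add_mul, one_mul]; exact this.le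
      exact_mod_cast h2
    calc ((2 * M / (D + 1) : ℕ) : ℝ) ≤ ((2 * M : ℕ) : ℝ) / ((D + 1 : ℕ) : ℝ) := Nat.cast_div_le
      _ = 2 * M / ((D : ℝ) + 1) := by push_cast; ring
      _ ≤ 2 * M / ((r : ℝ) / (2 * H ^ 2)) := by gcongr
      _ = _ := by field_simp; ring
  have hsplit := fiberEnergy_le_card_mul_sum (S := primPairs r j M H) (δ := pairDiff)
    (K := range n) (κ := fun p => tot p / (D + 1)) (fun p hp => by
      rw [mem_range, hn, Nat.lt_succ_iff]
      exact Nat.div_le_div_right (hcM p hp))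
  rw [card_range] at hsplit
  have hcell : ∀ k ∈ range n,
      (fiberEnergy ((primPairs r j M H).filter fun p => tot p / (D + 1) = k) pairDiff : ℝ) ≤
      6 * T ^ 2 * ((primPairs r j M H).filter fun p => tot p / (D + 1) = k).card +
        2592 * T ^ 9 * V * H := by
    intro k _
    refine fiberEnergy_cell_le hcop hM hH ?_ ((min_le_right _ _).trans (by omega)) hT hL
      (filter_subset _ _) ?_
    · calc 2 * H ^ 2 * V ≤ 2 * H ^ 2 * D := by gcongr; exact min_le_left _ _
        _ ≤ r := Nat.mul_div_le _ _
    · intro p hp q hq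
      obtain ⟨hp, hpk⟩ := mem_filter.1 hp
      obtain ⟨hq, hqk⟩ := mem_filter.1 hq
      have h1 := hcM p hp
      have h2 := hcM q hq
      have e1 := Nat.div_add_mod (tot p) (D + 1)
      have e2 := Nat.div_add_mod (tot q) (D + 1)
      rw [hpk] at e1
      rw [hqk] at e2
      have m1 : tot p % (D + 1) < D + 1 := Nat.mod_lt _ (Nat.succ_pos D)
      have m2 : tot q % (D + 1) < D + 1 := Nat.mod_lt _ (Nat.succ_pos D)
      generalize (D + 1) * k = y at e1 e2
      rw [Nat.cast_min, le_min_iff, abs_le, abs_le]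
      omega
  have hcard : ∑ k ∈ range n,
      (((primPairs r j M H).filter fun p => tot p / (D + 1) = k).card : ℝ) ≤ 32 * T ^ 3 * H * M := by
    have h1 : (primPairs r j M H).card = ∑ k ∈ range n,
        ((primPairs r j M H).filter fun p => tot p / (D + 1) = k).card :=
      card_eq_sum_card_fiberwise (fun p hp => by
        rw [mem_coe, mem_range, hn, Nat.lt_succ_iff]
        exact Nat.div_le_div_right (hcM p hp))
    have h2 : ((primPairs r j M H).card : ℝ) ≤ (closePairs r j M H).card := by
      exact_mod_cast card_le_card (filter_subset _ _)
    rw [h1] at h2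
    push_cast at h2
    exact h2.trans (card_closePairs_le hcop hT)
  have hsum : ∑ k ∈ range n,
      (fiberEnergy ((primPairs r j M H).filter fun p => tot p / (D + 1) = k) pairDiff : ℝ) ≤
      10560 * T ^ 9 * (H * M) := by
    refine (sum_le_sum hcell).trans ?_
    rw [sum_add_distrib, ← mul_sum, sum_const, card_range, nsmul_eq_mul]
    have h1 : ((n * V : ℕ) : ℝ) ≤ ((4 * M : ℕ) : ℝ) := by exact_mod_cast hnV
    push_cast at h1
    have h5 : T ^ 5 ≤ T ^ 9 := pow_le_pow_right₀ hT1 (by norm_num)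
    calc _ ≤ 6 * T ^ 2 * (32 * T ^ 3 * H * M) + 2592 * T ^ 9 * (n * V) * H := by
          have := mul_le_mul_of_nonneg_left hcard (by positivity : 0 ≤ 6 * T ^ 2)
          linarith
      _ ≤ 6 * T ^ 2 * (32 * T ^ 3 * H * M) + 2592 * T ^ 9 * (4 * M) * H := by gcongr
      _ = 192 * (H * M) * T ^ 5 + 10368 * T ^ 9 * (H * M) := by ring
      _ ≤ 192 * (H * M) * T ^ 9 + 10368 * T ^ 9 * (H * M) := by gcongr
      _ = _ := by ring
  calc (fiberEnergy (primPairs r j M H) pairDiff : ℝ) ≤ n * ∑ k ∈ range n,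
      (fiberEnergy ((primPairs r j M H).filter fun p => tot p / (D + 1) = k) pairDiff : ℝ) := by
        exact_mod_cast hsplit
    _ ≤ (4 * H ^ 2 * M / r + 1) * (10560 * T ^ 9 * (H * M)) := by gcongr
    _ = _ := by ring

theorem fiberEnergy_primPairs_le (hcop : Nat.Coprime r j) (hHM : H ≤ M) (hM : M ≤ r)
    (hT : ∀ n : ℕ, 0 < n → n ≤ r → (n.divisors.card : ℝ) ≤ T)
    (hL : ∀ N : ℕ, N ≤ 4 * r → ∑ w ∈ Icc 1 N, (1 : ℝ) / w ≤ T) :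
    (fiberEnergy (primPairs r j M H) pairDiff : ℝ) ≤
      42240 * T ^ 9 * (H ^ 3 * M ^ 2 / r + H * M) := by
  have hr : 0 < r := Nat.pos_of_ne_zero (NeZero.ne r)
  have hT1 : 1 ≤ T := by simpa using hT 1 one_pos hr
  have htriv : (fiberEnergy (primPairs r j M H) pairDiff : ℝ) ≤ 128 * T ^ 3 * H ^ 2 * M :=
    le_trans (by exact_mod_cast fiberEnergy_mono (filter_subset _ _) _)
      (fiberEnergy_closePairs_le_trivial hcop hM hT)
  rcases Nat.eq_zero_or_pos H with h0 | hH0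
  · rw [h0] at htriv ⊢
    refine htriv.trans (le_of_eq ?_)
    simp
  rcases lt_or_ge (H * M) r with hlt | hge
  · refine (fiberEnergy_primPairs_le_of_lt hcop hH0 hHM hM hlt hT hL).trans ?_
    have h1 : 0 ≤ 10560 * T ^ 9 * (H * M : ℝ) := by positivity
    calc _ = 42240 * T ^ 9 * (H ^ 3 * M ^ 2 / r) + 10560 * T ^ 9 * (H * M) := by ring
      _ ≤ 42240 * T ^ 9 * (H ^ 3 * M ^ 2 / r) + 42240 * T ^ 9 * (H * M) := by linarith
      _ = _ := by ring
  · have h1 : (1 : ℝ) ≤ H * M / r := by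
      rw [one_le_div (by positivity)]; exact_mod_cast hge
    have h3 : T ^ 3 ≤ T ^ 9 := pow_le_pow_right₀ hT1 (by norm_num)
    calc _ ≤ _ := htriv
      _ ≤ 128 * T ^ 3 * H ^ 2 * M * (H * M / r) := le_mul_of_one_le_right (by positivity) h1
      _ = 128 * T ^ 3 * (H ^ 3 * M ^ 2 / r) := by ring
      _ ≤ 42240 * T ^ 9 * (H ^ 3 * M ^ 2 / r + H * M) := by
        gcongr
        · norm_num
        · exact le_add_of_nonneg_right (by positivity)

/-- Under H, M, r ↦ H/f², M/f², r/f² the term HM shrinks by f⁴ and H³M²/r by f⁸, which pays for the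
f⁴ lifts. -/
theorem fiberEnergy_maxFactor_filter_le (hcop : Nat.Coprime r j) (hHM : H ≤ M) (hM : M ≤ r)
    (hT : ∀ n : ℕ, 0 < n → n ≤ r → (n.divisors.card : ℝ) ≤ T)
    (hL : ∀ N : ℕ, N ≤ 4 * r → ∑ w ∈ Icc 1 N, (1 : ℝ) / w ≤ T) {f : ℕ} (hf : f * f ∣ r) :
    (fiberEnergy ((closePairs r j M H).filter fun p => maxFactor p = f) pairDiff : ℝ) ≤
      42240 * T ^ 9 * (H ^ 3 * M ^ 2 / r + H * M) := by
  obtain ⟨R, hR⟩ := hf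
  have hr : 0 < r := Nat.pos_of_ne_zero (NeZero.ne r)
  have hT1 : 1 ≤ T := by simpa using hT 1 one_pos hr
  have hff0 : 0 < f * f := Nat.pos_of_ne_zero fun h => by rw [h, zero_mul] at hR; omega
  have hR0 : 0 < R := Nat.pos_of_ne_zero fun h => by rw [h, mul_zero] at hR; omega
  have : NeZero R := ⟨hR0.ne'⟩
  have hRr : R ≤ r := Nat.le_of_dvd hr ⟨f * f, by rw [hR, mul_comm]⟩
  have hf1 : (1 : ℝ) ≤ f := by exact_mod_cast Nat.pos_of_mul_pos_left hff0
  have hf0 : (0 : ℝ) < f := by linarith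
  have h1 := fiberEnergy_primPairs_le (r := R) (j := j) (M := M / (f * f)) (H := H / (f * f)) (T := T)
    (Nat.Coprime.coprime_dvd_left ⟨f * f, by rw [hR, mul_comm]⟩ hcop)
    (Nat.div_le_div_right hHM)
    (by rw [Nat.div_le_iff_le_mul_add_pred hff0]; rw [hR] at hM; omega)
    (fun n h0 hn => hT n h0 (hn.trans hRr)) (fun N hN => hL N (hN.trans (by omega)))
  have h2 : (fiberEnergy ((closePairs r j M H).filter fun p => maxFactor p = f) pairDiff : ℝ) ≤
      (f : ℝ) ^ 4 * fiberEnergy (primPairs R j (M / (f * f)) (H / (f * f))) pairDiff := by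
    exact_mod_cast fiberEnergy_maxFactor_le hcop hR hM
  have hHf : ((H / (f * f) : ℕ) : ℝ) ≤ H / f ^ 2 := by
    refine Nat.cast_div_le.trans (le_of_eq ?_); push_cast; ring
  have hMf : ((M / (f * f) : ℕ) : ℝ) ≤ M / f ^ 2 := by
    refine Nat.cast_div_le.trans (le_of_eq ?_); push_cast; ring
  have hRf : (r : ℝ) = f ^ 2 * R := by rw [hR]; push_cast; ring
  have hR0' : (0 : ℝ) < R := by exact_mod_cast hR0
  calc _ ≤ _ := h2
    _ ≤ (f : ℝ) ^ 4 * (42240 * T ^ 9 * ((H / f ^ 2) ^ 3 * (M / f ^ 2) ^ 2 / R +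
          (H / f ^ 2) * (M / f ^ 2))) := by
        gcongr
        refine h1.trans ?_
        gcongr
    _ = 42240 * T ^ 9 * ((H ^ 3 * M ^ 2 / r) / f ^ 4 + H * M) := by
        rw [hRf]; field_simp
    _ ≤ _ := by
        have : (H : ℝ) ^ 3 * M ^ 2 / r / f ^ 4 ≤ (H : ℝ) ^ 3 * M ^ 2 / r :=
          div_le_self (by positivity) (one_le_pow₀ hf1)
        exact mul_le_mul_of_nonneg_left (by linarith) (by positivity)

/-- At most T values of f occur; they cost T once in Cauchy–Schwarz and once in the summation. -/
theorem fiberEnergy_closePairs_le (hcop : Nat.Coprime r j) (hHM : H ≤ M) (hM : M ≤ r)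
    (hT : ∀ n : ℕ, 0 < n → n ≤ r → (n.divisors.card : ℝ) ≤ T)
    (hL : ∀ N : ℕ, N ≤ 4 * r → ∑ w ∈ Icc 1 N, (1 : ℝ) / w ≤ T) :
    (fiberEnergy (closePairs r j M H) pairDiff : ℝ) ≤
      42240 * T ^ 11 * (H ^ 3 * M ^ 2 / r + H * M) := by
  have hr : 0 < r := Nat.pos_of_ne_zero (NeZero.ne r)
  have hT1 : 1 ≤ T := by simpa using hT 1 one_pos hr
  set K := r.divisors.filter fun f => f * f ∣ r with hK
  have hKT : (K.card : ℝ) ≤ T :=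
    le_trans (by exact_mod_cast card_le_card (filter_subset _ _)) (hT r hr le_rfl)
  have h1 := fiberEnergy_le_card_mul_sum (S := closePairs r j M H) (δ := pairDiff)
    (K := K) (κ := maxFactor) (fun p _ => by
      obtain ⟨h1, h2, -⟩ := mem_filter.1 (maxFactor_mem p)
      exact mem_filter.2 ⟨h1, h2⟩)
  have h2 : (fiberEnergy (closePairs r j M H) pairDiff : ℝ) ≤ K.card * ∑ f ∈ K,
      (fiberEnergy ((closePairs r j M H).filter fun p => maxFactor p = f) pairDiff : ℝ) := by
    exact_mod_cast h1
  have h3 := sum_le_card_nsmul K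
    (fun f => (fiberEnergy ((closePairs r j M H).filter fun p => maxFactor p = f) pairDiff : ℝ)) _
    (fun f hf => fiberEnergy_maxFactor_filter_le hcop hHM hM hT hL (mem_filter.1 hf).2)
  rw [nsmul_eq_mul] at h3
  calc _ ≤ _ := h2
    _ ≤ T * (T * (42240 * T ^ 9 * (H ^ 3 * M ^ 2 / r + H * M))) := by
        gcongr
        exact h3.trans (by gcongr)
    _ = _ := by ring

end Energy

/-! ### From tuples with real parameters to energies, and the final choice of constants. -/

theorem closePair_floor {H : ℝ} (hH : 0 ≤ H) {a b : ℕ} (h : ClosePair H a b) :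
    a ≠ b ∧ |(a : ℤ) - b| ≤ (⌊H⌋₊ : ℕ) := by
  refine ⟨?_, ?_⟩
  · rintro rfl
    have := h.1
    simp at this
    linarith
  · have h1 : ((|(a : ℤ) - b| : ℤ) : ℝ) ≤ H := by push_cast; exact h.2
    have h2 : |(a : ℤ) - b| ≤ ⌊H⌋ := Int.le_floor.2 h1
    rwa [← Int.natCast_floor_eq_floor hH] at h2

section Count

variable {r j : ℕ} [NeZero r] {M H : ℝ}

theorem rootTuples_mem_rootPts {n : ℕ} {p : (Fin n → ℕ) × (Fin n → ZMod r)}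
    (hp : p ∈ rootTuples n r j M) (i : Fin n) : (p.1 i, p.2 i) ∈ rootPts r j ⌊M⌋₊ :=
  mem_rootPts.2 ⟨⟨(hp i).1, Nat.le_floor (hp i).2.1⟩, (hp i).2.2⟩

theorem mem_closePairs_floor (hH : 0 ≤ H) {n : ℕ} {p : (Fin n → ℕ) × (Fin n → ZMod r)}
    (hp : p ∈ rootTuples n r j M) {i k : Fin n} (h : ClosePair H (p.1 i) (p.1 k)) :
    ((p.1 i, p.2 i), (p.1 k, p.2 k)) ∈ closePairs r j ⌊M⌋₊ ⌊H⌋₊ :=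
  mem_closePairs.2 ⟨⟨rootTuples_mem_rootPts hp i, rootTuples_mem_rootPts hp k⟩,
    closePair_floor hH h⟩

theorem E2_le_fiberEnergy (hH : 0 ≤ H) :
    E2 r j M H ≤ fiberEnergy (closePairs r j ⌊M⌋₊ ⌊H⌋₊) pairDiff := by
  rw [← card_filter_eq, E2, ← Set.ncard_coe_finset]
  refine Set.ncard_le_ncard_of_injOn
    (fun p => (((p.1 0, p.2 0), (p.1 1, p.2 1)), ((p.1 2, p.2 2), (p.1 3, p.2 3)))) ?_ ?_
    (finite_toSet _)
  · rintro p ⟨hp, h1, h2, h3⟩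
    rw [mem_coe, mem_filter, mem_product]
    exact ⟨⟨mem_closePairs_floor hH hp h1, mem_closePairs_floor hH hp h2⟩, h3⟩
  · intro p _ q _ h
    simp only [Prod.mk.injEq] at h
    refine Prod.ext (funext fun i => ?_) (funext fun i => ?_) <;> fin_cases i <;> tauto

theorem E4_le_fiberEnergy (hH : 0 ≤ H) :
    E4 r j M H ≤ (closePairs r j ⌊M⌋₊ ⌊H⌋₊).card ^ 2 *
      fiberEnergy (closePairs r j ⌊M⌋₊ ⌊H⌋₊) pairDiff := by
  refine le_trans ?_ (card_filter_add_eq_add_le _ _)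
  rw [E4, ← Set.ncard_coe_finset]
  refine Set.ncard_le_ncard_of_injOn
    (fun p => ((((p.1 0, p.2 0), (p.1 1, p.2 1)), ((p.1 2, p.2 2), (p.1 3, p.2 3))),
      (((p.1 4, p.2 4), (p.1 5, p.2 5)), ((p.1 6, p.2 6), (p.1 7, p.2 7))))) ?_ ?_
    (finite_toSet _)
  · rintro p ⟨hp, h1, h2, h3, h4, h5⟩
    rw [mem_coe, mem_filter, mem_product, mem_product, mem_product]
    refine ⟨⟨⟨mem_closePairs_floor hH hp h1, mem_closePairs_floor hH hp h2⟩,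
      mem_closePairs_floor hH hp h3, mem_closePairs_floor hH hp h4⟩, ?_⟩
    simp only [pairDiff]
    linear_combination h5
  · intro p _ q _ h
    simp only [Prod.mk.injEq] at h
    refine Prod.ext (funext fun i => ?_) (funext fun i => ?_) <;> fin_cases i <;> tauto

end Count

theorem sum_one_div_le_rpow {δ : ℝ} (hδ : 0 < δ) {r N : ℕ} (hr : 0 < r) (hN : N ≤ 4 * r) :
    ∑ w ∈ Icc 1 N, (1 : ℝ) / w ≤ (1 + 4 ^ δ / δ) * (r : ℝ) ^ δ := by
  have hr1 : (1 : ℝ) ≤ r := by exact_mod_cast hr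
  have h1 : ∑ w ∈ Icc 1 N, (1 : ℝ) / w ≤ ∑ w ∈ Icc 1 (4 * r), (1 : ℝ) / w :=
    sum_le_sum_of_subset_of_nonneg (Icc_subset_Icc_right hN) fun _ _ _ => by positivity
  have h2 : ∑ w ∈ Icc 1 (4 * r), (1 : ℝ) / w = ((harmonic (4 * r) : ℚ) : ℝ) := by
    rw [harmonic_eq_sum_Icc]; push_cast; simp only [one_div]
  have h3 := harmonic_le_one_add_log (4 * r)
  have h4 : Real.log ((4 * r : ℕ) : ℝ) ≤ ((4 * r : ℕ) : ℝ) ^ δ / δ :=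
    Real.log_le_rpow_div (by positivity) hδ
  have h5 : ((4 * r : ℕ) : ℝ) ^ δ = 4 ^ δ * (r : ℝ) ^ δ := by
    push_cast; rw [Real.mul_rpow (by norm_num) (by positivity)]
  rw [h5] at h4
  have h6 : (1 : ℝ) ≤ (r : ℝ) ^ δ := Real.one_le_rpow hr1 hδ.le
  calc _ ≤ 1 + 4 ^ δ * (r : ℝ) ^ δ / δ := by linarith
    _ ≤ (r : ℝ) ^ δ + 4 ^ δ * (r : ℝ) ^ δ / δ := by gcongr
    _ = _ := by ring

end

theorem theorem4 (ε : ℝ) (hε : 0 < ε) :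
    ∃ C : ℝ, 0 < C ∧
      ∀ (r j : ℕ) (M H : ℝ), 0 < r → 0 < j → Nat.Coprime r j → 1 ≤ H → H ≤ M → M ≤ (r : ℝ) →
        (E2 r j M H : ℝ) ≤ C * ((H ^ 3 * M ^ 2 / (r : ℝ) + H * M) * (r : ℝ) ^ ε) ∧
        (E4 r j M H : ℝ) ≤
          C * (H ^ 2 * M ^ 2 * (H ^ 3 * M ^ 2 / (r : ℝ) + H * M) * (r : ℝ) ^ ε) := by
  -- The E₄ bound uses T¹¹ from the energy and (T³)² from the number of pairs, in total T¹⁷.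
  set δ := ε / 17 with hδ
  have hδ0 : 0 < δ := by positivity
  obtain ⟨A, hA1, hA⟩ := exists_card_divisors_le_rpow hδ0
  set B : ℝ := 1 + 4 ^ δ / δ with hB
  have hB1 : 0 < B := by positivity
  -- 43253760 = 32² · 42240, as needed for E₄; the weaker requirement of E₂ is absorbed.
  refine ⟨43253760 * (A + B) ^ 17, by positivity, fun r j M H hr _ hcop hH1 hHM hMr => ?_⟩
  have : NeZero r := ⟨hr.ne'⟩
  have hH0 : 0 ≤ H := by linarith
  have hM0 : 0 ≤ M := by linarith
  have hr1 : (1 : ℝ) ≤ r := by exact_mod_cast hr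
  set T : ℝ := (A + B) * (r : ℝ) ^ δ with hTdef
  have hT : ∀ n : ℕ, 0 < n → n ≤ r → (n.divisors.card : ℝ) ≤ T := by
    intro n hn hnr
    have hnr' : (n : ℝ) ≤ r := by exact_mod_cast hnr
    calc _ ≤ A * (n : ℝ) ^ δ := hA n hn.ne'
      _ ≤ (A + B) * (r : ℝ) ^ δ := by gcongr; linarith
  have hL : ∀ N : ℕ, N ≤ 4 * r → ∑ w ∈ Finset.Icc 1 N, (1 : ℝ) / w ≤ T := by
    intro N hN
    refine (sum_one_div_le_rpow hδ0 hr hN).trans ?_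
    rw [hTdef, ← hB]
    gcongr
    linarith
  have hT1 : 1 ≤ T := by simpa using hT 1 one_pos hr
  have hT17 : T ^ 17 = (A + B) ^ 17 * (r : ℝ) ^ ε := by
    rw [hTdef, mul_pow, ← Real.rpow_natCast ((r : ℝ) ^ δ), ← Real.rpow_mul (by positivity), hδ]
    congr 2
    push_cast; ring
  have hHM' : ⌊H⌋₊ ≤ ⌊M⌋₊ := Nat.floor_mono hHM
  have hMr' : ⌊M⌋₊ ≤ r := Nat.floor_le_of_le hMr
  have hHf := Nat.floor_le hH0
  have hMf := Nat.floor_le hM0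
  set X : ℝ := H ^ 3 * M ^ 2 / (r : ℝ) + H * M with hX
  have hX0 : 0 ≤ X := by positivity
  have henergy : (fiberEnergy (closePairs r j ⌊M⌋₊ ⌊H⌋₊) pairDiff : ℝ) ≤ 42240 * T ^ 11 * X := by
    refine (fiberEnergy_closePairs_le hcop hHM' hMr' hT hL).trans ?_
    rw [hX]
    gcongr
  have hcard : ((closePairs r j ⌊M⌋₊ ⌊H⌋₊).card : ℝ) ≤ 32 * T ^ 3 * H * M := by
    refine (card_closePairs_le hcop hT).trans ?_
    gcongr
  constructor
  · calc (E2 r j M H : ℝ) ≤ (fiberEnergy (closePairs r j ⌊M⌋₊ ⌊H⌋₊) pairDiff : ℝ) := by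
          exact_mod_cast E2_le_fiberEnergy hH0
      _ ≤ 42240 * T ^ 11 * X := henergy
      _ ≤ 43253760 * T ^ 17 * X := by
          gcongr
          · norm_num
          · norm_num
      _ = _ := by rw [hT17]; ring
  · calc (E4 r j M H : ℝ) ≤ ((closePairs r j ⌊M⌋₊ ⌊H⌋₊).card : ℝ) ^ 2 *
          (fiberEnergy (closePairs r j ⌊M⌋₊ ⌊H⌋₊) pairDiff : ℝ) := by
          exact_mod_cast E4_le_fiberEnergy hH0
      _ ≤ (32 * T ^ 3 * H * M) ^ 2 * (42240 * T ^ 11 * X) := by gcongr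
      _ = 43253760 * T ^ 17 * (H ^ 2 * M ^ 2 * X) := by ring
      _ = _ := by rw [hT17]; ring
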